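/- Consider an $N$-level open quantum system with $\hbar>0$, Hermitian free Hamiltonian $H_0$, Hermitian control Hamiltonian $H_c(t)$ that is integrable and right-continuous on $[t_0,t_f]$ (for instance continuous), Lindblad operators $L_1,\dots,L_K\in\mathbb C^{N\times N}$ and decay rates $\gamma_k\ge 0$. For $\Omega\subset\mathbb R$ let $\mathcal U$ be the set of measurable, essentially bounded controls $u$ on $[t_0,t_f]$ with $u(t)\in\Omega$ for a.e. $t$. For $u\in\mathcal U$ the trajectory is the absolutely continuous $\rho$ on $[t_0,t_f]$ with $\rho(t_0)=\rho_0$, where $\rho_0$ is a given density matrix (Hermitian, positive semidefinite, of trace one), and, for a.e. $t$, $$\dot\rho=-\tfrac{i}{\hbar}[H_0+u(t)H_c(t),\rho]+\sum_k\gamma_k\big(L_k\rho L_k^\dagger-\tfrac12\{L_k^\dagger L_k,\rho\}\big).$$ Put $\delta_{jk}^{\mathrm{Re}}=|j\rangle\langle k|+|k\rangle\langle j|$, $\delta_{jk}^{\mathrm{Im}}=-i|j\rangle\langle k|+i|k\rangle\langle j|$, $\langle A\rangle_\rho=\mathrm{Tr}(\rho A)$, $$C(\rho)=\Big(\sum_{j<k}\langle\delta_{jk}^{\mathrm{Re}}\rangle_\rho^2+\langle\delta_{jk}^{\mathrm{Im}}\rangle_\rho^2\Big)^{1/2},\qquad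 \Phi(t,\rho)=-2i\sum_{j<k}\Big(\langle\delta_{jk}^{\mathrm{Re}}\rangle_\rho\langle[\delta_{jk}^{\mathrm{Re}},H_c(t)]\rangle_\rho+\langle\delta_{jk}^{\mathrm{Im}}\rangle_\rho\langle[\delta_{jk}^{\mathrm{Im}},H_c(t)]\rangle_\rho\Big).$$ Let $C^2(\rho_0)\in[\alpha,\beta]$ and $\varepsilon>0$. Then there is $M>0$ such that the following holds for every $\Omega\subset\mathbb R$ with $[-M,M]\subset\Omega$. Suppose that $|\Phi(t,\rho(t))|\ge\varepsilon$ for every trajectory $\rho$ of a control in $\mathcal U$ and every $t\in[t_0,t_f]$ such that $C^2(\rho(s))\in[\alpha,\beta]$ for all $s\in[t_0,t]$. Then the set $$\bar{\mathcal U}=\{u\in\mathcal U:\ C^2(\rho(t))\in[\alpha,\beta]\ \text{ for all } t\in[t_0,t_f]\}$$ is nonempty. If moreover $\Omega$ is a compact interval, then $\bar{\mathcal U}$ contains an optimal control $u^\star$, that is, one with $\int_{t_0}^{t_f}u^\star(t)^2\,dt\le\int_{t_0}^{t_f}u(t)^2\,dt$ for all $u\in\bar{\mathcal U}$. -/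

import Mathlib

open MeasureTheory Set
open scoped Matrix ComplexOrder

noncomputable section

/-- `N × N` complex matrices. -/
abbrev CMat (N : ℕ) : Type := Matrix (Fin N) (Fin N) ℂ

/-- Density matrices: Hermitian, positive semidefinite (`PosSemidef` contains both), trace one. -/
def IsDensityMatrix {N : ℕ} (ρ : CMat N) : Prop :=
  ρ.PosSemidef ∧ ρ.trace = 1

/-- The expectation value `⟨A⟩_ρ = Tr (ρ A)`. -/
def expVal {N : ℕ} (ρ A : CMat N) : ℂ := (ρ * A).trace

/-- `δ_{jk}^{Re} = |j⟩⟨k| + |k⟩⟨j|`. -/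
def deltaRe {N : ℕ} (j k : Fin N) : CMat N :=
  Matrix.single j k 1 + Matrix.single k j 1

/-- `δ_{jk}^{Im} = -i |j⟩⟨k| + i |k⟩⟨j|`. -/
def deltaIm {N : ℕ} (j k : Fin N) : CMat N :=
  Matrix.single j k (-Complex.I) + Matrix.single k j Complex.I

/-- The pairs `j < k` of levels. -/
def levelPairs (N : ℕ) : Finset (Fin N × Fin N) :=
  Finset.univ.filter fun p => p.1 < p.2

/-- The coherence function `C(ρ)`. The expectation values of the Hermitian operators
`deltaRe`, `deltaIm` in a Hermitian `ρ` are real, so taking real parts loses nothing. -/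
def coherence {N : ℕ} (ρ : CMat N) : ℝ :=
  Real.sqrt (∑ p ∈ levelPairs N,
    ((expVal ρ (deltaRe p.1 p.2)).re ^ 2 + (expVal ρ (deltaIm p.1 p.2)).re ^ 2))

/-- The function
`Φ = -2i ∑_{j<k} (⟨δ^{Re}⟩_ρ ⟨[δ^{Re}, H_c]⟩_ρ + ⟨δ^{Im}⟩_ρ ⟨[δ^{Im}, H_c]⟩_ρ)`. -/
def Phi {N : ℕ} (Hc ρ : CMat N) : ℂ :=
  -2 * Complex.I * ∑ p ∈ levelPairs N,
    (expVal ρ (deltaRe p.1 p.2) * expVal ρ ⁅deltaRe p.1 p.2, Hc⁆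
      + expVal ρ (deltaIm p.1 p.2) * expVal ρ ⁅deltaIm p.1 p.2, Hc⁆)

/-- A controlled open quantum system with `N` levels and `K` decoherence channels. -/
structure OpenSystem (N K : ℕ) where
  /-- reduced Planck constant -/
  hbar : ℝ
  hbar_pos : 0 < hbar
  /-- free Hamiltonian -/
  H₀ : CMat N
  H₀_herm : H₀.IsHermitian
  /-- control Hamiltonian; the total Hamiltonian is `H₀ + u(t) H_c(t)` -/
  Hc : ℝ → CMat N
  Hc_herm : ∀ t, (Hc t).IsHermitian
  /-- decay rates -/
  γ : Fin K → ℝ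
  γ_nonneg : ∀ k, 0 ≤ γ k
  /-- Lindblad operators -/
  L : Fin K → CMat N

namespace OpenSystem

variable {N K : ℕ} (S : OpenSystem N K)

/-- `𝓛(ρ) = ∑ₖ γₖ (Lₖ ρ Lₖ† - ½ {Lₖ† Lₖ, ρ})`. -/
def dissipator (ρ : CMat N) : CMat N :=
  ∑ k, (S.γ k : ℂ) • (S.L k * ρ * (S.L k)ᴴ
    - (1 / 2 : ℂ) • ((S.L k)ᴴ * S.L k * ρ + ρ * ((S.L k)ᴴ * S.L k)))

/-- Right-hand side of the Lindblad equation at time `t` with control value `v`: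
`-(i/ℏ) [H₀ + v H_c(t), ρ] + 𝓛(ρ)`. -/
def rhs (t v : ℝ) (ρ : CMat N) : CMat N :=
  (-(Complex.I / (S.hbar : ℂ))) • ⁅S.H₀ + (v : ℂ) • S.Hc t, ρ⁆ + S.dissipator ρ

/-- `ρ` is the state trajectory on `[t₀, t_f]` for the control `u` and initial state `ρ₀`:
absolutely continuous, with the Lindblad equation satisfied at almost every time
(entry by entry). -/
def IsTrajectory (t₀ tf : ℝ) (ρ₀ : CMat N) (u : ℝ → ℝ) (ρ : ℝ → CMat N) : Prop :=
  ρ t₀ = ρ₀ ∧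
  (∀ i j, AbsolutelyContinuousOnInterval (fun t => ρ t i j) t₀ tf) ∧
  ∀ᵐ t ∂(volume.restrict (Icc t₀ tf)),
    ∀ i j, HasDerivAt (fun s => ρ s i j) (S.rhs t (u t) (ρ t) i j) t

/-- The set `𝓤` of measurable, essentially bounded controls on `[t₀, t_f]` with values in `Ω`
almost everywhere. -/
def controls (t₀ tf : ℝ) (Ω : Set ℝ) : Set (ℝ → ℝ) :=
  {u | MemLp u ⊤ (volume.restrict (Icc t₀ tf)) ∧
    ∀ᵐ t ∂(volume.restrict (Icc t₀ tf)), u t ∈ Ω}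

/-- The controls in `𝓤` whose trajectory satisfies `C²(ρ(t)) ∈ [α, β]` for all
`t ∈ [t₀, t_f]`. -/
def feasibleControls (t₀ tf : ℝ) (ρ₀ : CMat N) (α β : ℝ) (Ω : Set ℝ) : Set (ℝ → ℝ) :=
  {u | u ∈ controls t₀ tf Ω ∧ ∃ ρ : ℝ → CMat N, S.IsTrajectory t₀ tf ρ₀ u ρ ∧
    ∀ t ∈ Icc t₀ tf, coherence (ρ t) ^ 2 ∈ Icc α β}

/-- `|Φ| ≥ ε` along all admissible trajectories, for as long as they respect the coherence
bounds. -/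
def PhiBoundedAway (t₀ tf : ℝ) (ρ₀ : CMat N) (α β : ℝ) (Ω : Set ℝ) (ε : ℝ) : Prop :=
  ∀ u ∈ controls t₀ tf Ω, ∀ ρ : ℝ → CMat N, S.IsTrajectory t₀ tf ρ₀ u ρ →
    ∀ t ∈ Icc t₀ tf, (∀ s ∈ Icc t₀ t, coherence (ρ s) ^ 2 ∈ Icc α β) →
      ε ≤ ‖Phi (S.Hc t) (ρ t)‖

end OpenSystem

/-- The energy `J(u) = ∫ u²` over `[t₀, t_f]`. -/
def controlEnergy (t₀ tf : ℝ) (u : ℝ → ℝ) : ℝ := ∫ t in t₀..tf, u t ^ 2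

end

/-! Along a trajectory the derivative of `C²` is affine in the control: a drift depending on `ρ`
alone, plus `u(t)` times a gain. For Hermitian `ρ` the gain is `Φ / ℏ`, by cyclicity of the trace
(`Phi_eq_coherenceDeriv`). The control `-drift / gain` therefore freezes `C²` wherever `Φ` does not
vanish.

To get a closed-loop trajectory without knowing in advance that `Φ` stays away from zero, the
quotient is replaced by `-drift * gain / max (gain²) (e²)` with `e = ε / (2ℏ)`. This law is
continuous, is bounded by `|drift| / e`, and equals `-drift / gain` where `|gain| ≥ e`. The
Hamiltonian part of the equation is orthogonal to `ρ` in the Frobenius inner product, so the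
dissipator alone bounds `ρ`, uniformly in the control (`frobSq_le_of_ae_hasDerivAt`). Hence the
drift is bounded by a constant `D` depending only on the system, the horizon and `ρ₀`, and `M = D /
e + 1` does not depend on `Ω`. Carathéodory's theorem, applied to a vector field retracted to a
large ball, gives the trajectory (`exists_isTrajectory_feedback`).

That `C²` is constant follows by continuous induction (`coherence_sq_eq_of_feedback`). If it has
been constant up to `t`, the hypothesis gives `|gain| ≥ ε / ℏ = 2e` at `t`. Right-continuity of
`H_c` keeps `|gain|` above `e` slightly beyond `t`, where the drift is still cancelled exactly.

The optimal control comes from the direct method. A minimising sequence of controls has a weak-*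
limit, and the trajectories converge by Arzelà–Ascoli. The equation is affine in the control, so
weak convergence of controls and strong convergence of states pass to the limit
(`tendsto_integral_rhs`). The coherence bounds are closed conditions, and the energy is weakly lower
semicontinuous. -/

/-! ### Arzelà–Ascoli with a common modulus of continuity. -/

section Compactness

open Filter Topology

/-- Sequential Arzelà–Ascoli for a bounded sequence of functions whose increments are dominated by
those of one continuous function. -/
theorem exists_subseq_tendsto_of_norm_sub_le {E : Type*} [NormedAddCommGroup E] [ProperSpace E]
    {a b : ℝ} (x : ℕ → ℝ → E) {G : ℝ → ℝ} (hG : ContinuousOn G (Icc a b)) {B : ℝ}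
    (hB : ∀ n, ∀ t ∈ Icc a b, ‖x n t‖ ≤ B)
    (hx : ∀ n, ∀ s ∈ Icc a b, ∀ t ∈ Icc a b, ‖x n t - x n s‖ ≤ |G t - G s|) :
    ∃ φ : ℕ → ℕ, StrictMono φ ∧ ∃ y : ℝ → E, ContinuousOn y (Icc a b) ∧
      ∀ t ∈ Icc a b, Tendsto (fun n => x (φ n) t) atTop (𝓝 (y t)) := by
  classical
  have hG' : Continuous fun t : Icc a b => G t := continuousOn_iff_continuous_domRestrict.1 hG
  have hcont : ∀ n, Continuous fun t : Icc a b => x n t := by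
    intro n
    rw [continuous_iff_continuousAt]
    intro s
    rw [ContinuousAt, tendsto_iff_norm_sub_tendsto_zero]
    have h0 : Tendsto (fun t : Icc a b => |G t - G s|) (𝓝 s) (𝓝 0) := by
      have := ((hG'.sub continuous_const).abs : Continuous fun t : Icc a b => |G t - G s|).tendsto s
      simpa using this
    exact squeeze_zero (fun _ => norm_nonneg _) (fun t => hx n s s.2 t t.2) h0
  let X : ℕ → BoundedContinuousFunction (Icc a b) E := fun n =>
    BoundedContinuousFunction.mkOfCompact ⟨fun t : Icc a b => x n t, hcont n⟩
  have hcpt : IsCompact (closure (range X)) := by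
    refine BoundedContinuousFunction.arzela_ascoli (Metric.closedBall 0 B)
      (isCompact_closedBall 0 B) (range X) ?_ ?_
    · rintro _ t ⟨n, rfl⟩
      rw [mem_closedBall_zero_iff]
      exact hB n t t.2
    · intro s
      rw [Metric.equicontinuousAt_iff]
      intro ε hε
      -- The modulus of continuity of `G` at `s` serves all members of the family at once.
      have h0 : ∀ᶠ t : Icc a b in 𝓝 s, dist (G t) (G s) < ε :=
        Metric.tendsto_nhds.1 (hG'.tendsto s) ε hε
      obtain ⟨δ, hδ, h⟩ := Metric.eventually_nhds_iff.1 h0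
      refine ⟨δ, hδ, fun t ht i => ?_⟩
      obtain ⟨_, n, rfl⟩ := i
      have h1 := hx n s s.2 t t.2
      have h2 := h ht
      rw [Real.dist_eq] at h2
      rw [dist_comm, dist_eq_norm]
      exact lt_of_le_of_lt h1 h2
  obtain ⟨Y, -, φ, hφ, hY⟩ :=
    hcpt.isSeqCompact fun n => subset_closure (mem_range_self (f := X) n)
  refine ⟨φ, hφ, fun t => if h : t ∈ Icc a b then Y ⟨t, h⟩ else 0, ?_, ?_⟩
  · rw [continuousOn_iff_continuous_domRestrict]
    convert Y.continuous using 1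
    ext t
    exact dif_pos t.2
  · intro t ht
    have := ((continuous_eval_const (F := BoundedContinuousFunction (Icc a b) E)
      (⟨t, ht⟩ : Icc a b)).tendsto Y).comp hY
    simp only [dif_pos ht]
    exact this

end Compactness

/-! ### Existence for Carathéodory equations by Tonelli's delayed approximations. -/

section Caratheodory

open Filter Topology

variable {E : Type*} [NormedAddCommGroup E] [NormedSpace ℝ E]

/-- The Tonelli operator with delay `h` for the initial value problem with
right-hand side `f` and value `x₀` at `a`. -/
noncomputable def tonelliStep (f : ℝ → E → E) (a h : ℝ) (x₀ : E) (x : ℝ → E) : ℝ → E :=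
  fun t => x₀ + ∫ s in a..t, f s (x (max a (s - h)))

/-- The delayed equation has a solution on `[a, b]`. -/
theorem exists_tonelliStep_fixed {f : ℝ → E → E} {m : ℝ → ℝ}
    (hmeas : ∀ x : ℝ → E, Continuous x → AEStronglyMeasurable (fun s => f s (x s)))
    (hm : Integrable m) (hfm : ∀ t x, ‖f t x‖ ≤ m t) (a b : ℝ) {h : ℝ} (hh : 0 < h) (x₀ : E) :
    ∃ x : ℝ → E, Continuous x ∧ ∀ t ∈ Icc a b, x t = tonelliStep f a h x₀ x t := by
  let X : ℕ → ℝ → E := fun k => (tonelliStep f a h x₀)^[k] fun _ => x₀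
  have hX : ∀ k, X (k + 1) = tonelliStep f a h x₀ (X k) := fun k =>
    Function.iterate_succ_apply' _ _ _
  have hcont : ∀ k, Continuous (X k) := by
    intro k
    induction k with
    | zero => exact continuous_const
    | succ k ih =>
      rw [hX]
      refine continuous_const.add (intervalIntegral.continuous_primitive (fun c d => ?_) a)
      refine Integrable.intervalIntegrable (hm.mono' ?_ (ae_of_all _ fun s => hfm _ _))
      exact hmeas (fun s => X k (max a (s - h))) (by fun_prop)
  -- On `[a, a + (k+1)h]` the operator reads its argument only on `[a, a + kh]`. Each iteration thus
  -- settles one more interval of length `h`, and no contraction is needed.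
  have key : ∀ k : ℕ, ∀ t ∈ Icc a (a + k * h), X (k + 1) t = X k t := by
    intro k
    induction k with
    | zero =>
      intro t ht
      have : t = a := by simpa using ht
      simp [hX, tonelliStep, this, X]
    | succ k ih =>
      intro t ht
      rw [hX (k + 1)]
      nth_rw 2 [hX k]
      simp only [tonelliStep]
      congr 1
      refine intervalIntegral.integral_congr fun s hs => ?_
      rw [uIcc_of_le ht.1] at hs
      have ht2 := ht.2
      push_cast at ht2
      have : max a (s - h) ∈ Icc a (a + k * h) := by
        refine ⟨le_max_left _ _, max_le ?_ ?_⟩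
        · have : 0 ≤ (k : ℝ) * h := by positivity
          linarith
        · linarith [hs.2]
      rw [ih _ this]
  obtain ⟨k, hk⟩ := exists_nat_ge ((b - a) / h)
  refine ⟨X k, hcont k, fun t ht => ?_⟩
  rw [← hX k, key k t ⟨ht.1, ?_⟩]
  rw [div_le_iff₀ hh] at hk
  linarith [ht.2]

/-- **Carathéodory's existence theorem**, for a right-hand side with an integrable majorant. -/
theorem exists_integral_eq_of_integrable_majorant [ProperSpace E] {f : ℝ → E → E} {m : ℝ → ℝ}
    {a b : ℝ} (hab : a ≤ b) (hcont : ∀ t ∈ Icc a b, Continuous (f t))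
    (hmeas : ∀ x : ℝ → E, Continuous x →
      AEStronglyMeasurable (fun s => f s (x s)) (volume.restrict (Icc a b)))
    (hm : IntegrableOn m (Icc a b)) (hfm : ∀ t ∈ Icc a b, ∀ x, ‖f t x‖ ≤ m t) (x₀ : E) :
    ∃ y : ℝ → E, Continuous y ∧ ∀ t ∈ Icc a b, y t = x₀ + ∫ s in a..t, f s (y s) := by
  classical
  -- Cutting off outside `[a, b]` supplies the bound and the measurability on all of `ℝ` that the
  -- delayed problem asks for.
  let g : ℝ → E → E := fun t x => (Icc a b).indicator (fun s => f s x) t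
  let M : ℝ → ℝ := (Icc a b).indicator m
  have hM : Integrable M := (integrable_indicator_iff measurableSet_Icc).2 hm
  have hgM : ∀ t x, ‖g t x‖ ≤ M t := by
    intro t x
    by_cases ht : t ∈ Icc a b
    · simpa [g, M, ht] using hfm t ht x
    · simp [g, M, ht]
  have hgmeas : ∀ x : ℝ → E, Continuous x → AEStronglyMeasurable (fun s => g s (x s)) := by
    intro x hx
    have := (aestronglyMeasurable_indicator_iff (μ := volume) measurableSet_Icc).2 (hmeas x hx)
    refine this.congr (ae_of_all _ fun s => ?_)
    by_cases hs : s ∈ Icc a b <;> simp [g, hs]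
  have hgcont : ∀ t, Continuous (g t) := by
    intro t
    by_cases ht : t ∈ Icc a b
    · simpa [g, ht] using! hcont t ht
    · simpa [g, ht] using! continuous_const
  choose X hXc hX using fun n : ℕ =>
    exists_tonelliStep_fixed hgmeas hM hgM a b (Nat.one_div_pos_of_nat (α := ℝ) (n := n)) x₀
  let G : ℝ → ℝ := fun t => ∫ s in a..t, M s
  have hGc : Continuous G := intervalIntegral.continuous_primitive
    (fun c d => hM.intervalIntegrable) a
  have hintg : ∀ n (c d : ℝ), IntervalIntegrable
      (fun s => g s (X n (max a (s - 1 / ((n : ℝ) + 1))))) volume c d := fun n c d =>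
    (hM.mono' (hgmeas (fun s => X n (max a (s - 1 / ((n : ℝ) + 1))))
      ((hXc n).comp (by fun_prop))) (ae_of_all _ fun s => hgM _ _)).intervalIntegrable
  have hinc : ∀ n, ∀ s ∈ Icc a b, ∀ t ∈ Icc a b, ‖X n t - X n s‖ ≤ |G t - G s| := by
    intro n s hs t ht
    rw [hX n t ht, hX n s hs]
    simp only [tonelliStep, G]
    rw [add_sub_add_left_eq_sub,
      intervalIntegral.integral_interval_sub_left (hintg n _ _) (hintg n _ _),
      intervalIntegral.integral_interval_sub_left hM.intervalIntegrable hM.intervalIntegrable]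
    exact intervalIntegral.norm_integral_le_abs_of_norm_le (ae_of_all _ fun r => hgM _ _)
      hM.intervalIntegrable
  have ha : a ∈ Icc a b := left_mem_Icc.2 hab
  obtain ⟨C, hC⟩ := isCompact_Icc.exists_bound_of_continuousOn (hGc.continuousOn (s := Icc a b))
  have hbd : ∀ n, ∀ t ∈ Icc a b, ‖X n t‖ ≤ ‖x₀‖ + C := by
    intro n t ht
    have h1 := hinc n a ha t ht
    have h2 : X n a = x₀ := by rw [hX n a ha]; simp [tonelliStep]
    have h3 : G a = 0 := by simp [G]
    rw [h2, h3, sub_zero] at h1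
    have h4 : ‖X n t‖ ≤ ‖x₀‖ + ‖X n t - x₀‖ := by
      simpa using norm_add_le x₀ (X n t - x₀)
    have := hC t ht
    rw [Real.norm_eq_abs] at this
    linarith
  obtain ⟨φ, hφ, y, hy, hlim⟩ :=
    exists_subseq_tendsto_of_norm_sub_le X hGc.continuousOn hbd hinc
  refine ⟨IccExtend hab ((Icc a b).domRestrict y),
    (continuousOn_iff_continuous_domRestrict.1 hy).Icc_extend', fun t ht => ?_⟩
  have hyext : ∀ s ∈ Icc a b, IccExtend hab ((Icc a b).domRestrict y) s = y s := fun s hs => by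
    rw [IccExtend_of_mem _ _ hs]; rfl
  rw [hyext t ht]
  have hφt : Tendsto φ atTop atTop := hφ.tendsto_atTop
  -- The delay tends to zero and the increments are controlled by `G` uniformly in `n`, so the
  -- delayed values have the same limit as the undelayed ones.
  have hdelay : ∀ s ∈ Icc a b,
      Tendsto (fun n => X (φ n) (max a (s - 1 / ((φ n : ℝ) + 1)))) atTop (𝓝 (y s)) := by
    intro s hs
    have hmem : ∀ n : ℕ, max a (s - 1 / ((n : ℝ) + 1)) ∈ Icc a b := fun n => by
      have : 0 < 1 / ((n : ℝ) + 1) := Nat.one_div_pos_of_nat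
      exact ⟨le_max_left _ _, max_le hab (by linarith [hs.2])⟩
    have hd : Tendsto (fun n => max a (s - 1 / ((φ n : ℝ) + 1))) atTop (𝓝 s) := by
      have h1 : Tendsto (fun n => s - 1 / ((φ n : ℝ) + 1)) atTop (𝓝 (s - 0)) :=
        tendsto_const_nhds.sub (tendsto_one_div_add_atTop_nhds_zero_nat.comp hφt)
      have h2 := (tendsto_const_nhds (x := a)).max h1
      simpa [max_eq_right hs.1] using h2
    have hz : Tendsto (fun n => |G (max a (s - 1 / ((φ n : ℝ) + 1))) - G s|) atTop (𝓝 0) := by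
      have := (((hGc.tendsto s).comp hd).sub_const (G s)).abs
      simpa using this
    have hz' := squeeze_zero_norm (fun n => hinc (φ n) s hs _ (hmem (φ n))) hz
    simpa using hz'.add (hlim s hs)
  have hconv : Tendsto (fun n => ∫ s in a..t, g s (X (φ n) (max a (s - 1 / ((φ n : ℝ) + 1)))))
      atTop (𝓝 (∫ s in a..t, f s (y s))) := by
    refine intervalIntegral.tendsto_integral_filter_of_dominated_convergence M
      (Eventually.of_forall fun n => ?_)
      (Eventually.of_forall fun n => ae_of_all _ fun s _ => hgM _ _)
      hM.intervalIntegrable (ae_of_all _ fun s hs => ?_)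
    · exact (hintg (φ n) a t).aestronglyMeasurable_restrict_uIoc
    · rw [uIoc_of_le ht.1] at hs
      have hs' : s ∈ Icc a b := ⟨hs.1.le, hs.2.trans ht.2⟩
      have := ((hgcont s).tendsto (y s)).comp (hdelay s hs')
      simpa [g, hs'] using! this
  have hlim' : Tendsto (fun n => X (φ n) t) atTop (𝓝 (x₀ + ∫ s in a..t, f s (y s))) := by
    refine (hconv.const_add x₀).congr fun n => ?_
    rw [hX (φ n) t ht]; rfl
  rw [tendsto_nhds_unique (hlim t ht) hlim']
  congr 1
  refine intervalIntegral.integral_congr fun s hs => ?_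
  rw [uIcc_of_le ht.1] at hs
  rw [hyext s ⟨hs.1, hs.2.trans ht.2⟩]

end Caratheodory

/-! ### Weak-* sequential compactness of bounded controls. -/

section WeakCompactness

open Filter Topology

/-- Sequential weak-* compactness of the functions with values in `[a, b]`, tested against
integrable functions. -/
theorem exists_subseq_tendsto_integral_mul {μ : Measure ℝ} [IsFiniteMeasure μ] {a b : ℝ}
    (u : ℕ → ℝ → ℝ) (hu : ∀ n, AEStronglyMeasurable (u n) μ)
    (hab : ∀ n, ∀ᵐ t ∂μ, u n t ∈ Icc a b) :
    ∃ φ : ℕ → ℕ, StrictMono φ ∧ ∃ v : ℝ → ℝ, AEStronglyMeasurable v μ ∧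
      (∀ᵐ t ∂μ, v t ∈ Icc a b) ∧
      ∀ g : ℝ → ℝ, Integrable g μ →
        Tendsto (fun n => ∫ t, u (φ n) t * g t ∂μ) atTop (𝓝 (∫ t, v t * g t ∂μ)) := by
  set R : ℝ := max |a| |b| with hR
  have hR0 : 0 ≤ R := le_max_of_le_left (abs_nonneg a)
  have hbd : ∀ {x : ℝ}, x ∈ Icc a b → ‖x‖ ≤ R := fun hx => abs_le_max_abs_abs hx.1 hx.2
  have hmem : ∀ n, MemLp (u n) 2 μ := fun n =>
    MemLp.of_bound (hu n) R ((hab n).mono fun t ht => hbd ht)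
  let U : ℕ → Lp ℝ 2 μ := fun n => (hmem n).toLp (u n)
  have hU : ∀ n, U n =ᵐ[μ] u n := fun n => (hmem n).coeFn_toLp
  obtain ⟨B, hB⟩ : ∃ B, ∀ n, ‖U n‖ ≤ B :=
    ⟨_, fun n => Lp.norm_le_of_ae_bound hR0 (((hU n).and (hab n)).mono fun t ht => by
      rw [ht.1]; exact hbd ht.2)⟩
  have : Fact ((1 : ENNReal) ≤ 2) := ⟨one_le_two⟩
  have : Fact ((2 : ENNReal) ≠ ⊤) := ⟨ENNReal.ofNat_ne_top⟩
  let D : ℕ → WeakDual ℝ (Lp ℝ 2 μ) := fun n =>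
    StrongDual.toWeakDual (InnerProductSpace.toDual ℝ (Lp ℝ 2 μ) (U n))
  have hD : ∀ n, D n ∈ WeakDual.toStrongDual ⁻¹'
      Metric.closedBall (0 : StrongDual ℝ (Lp ℝ 2 μ)) B := by
    intro n
    rw [mem_preimage, mem_closedBall_zero_iff]
    have : ‖InnerProductSpace.toDual ℝ (Lp ℝ 2 μ) (U n)‖ ≤ B := by
      rw [LinearIsometryEquiv.norm_map]; exact hB n
    exact this
  -- Banach–Alaoglu in `L²`, identified with its dual; separability of `L²` makes the ball
  -- sequentially compact.
  obtain ⟨ℓ, -, φ, hφ, hℓ⟩ := WeakDual.isSeqCompact_closedBall ℝ (Lp ℝ 2 μ) 0 B hD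
  let w : Lp ℝ 2 μ := (InnerProductSpace.toDual ℝ (Lp ℝ 2 μ)).symm (WeakDual.toStrongDual ℓ)
  have hw2 : MemLp w 2 μ := Lp.memLp w
  have hweak : ∀ g : ℝ → ℝ, MemLp g 2 μ →
      Tendsto (fun n => ∫ t, u (φ n) t * g t ∂μ) atTop (𝓝 (∫ t, w t * g t ∂μ)) := by
    intro g hg
    have h1 : Tendsto (fun n => D (φ n) (hg.toLp g)) atTop (𝓝 (ℓ (hg.toLp g))) :=
      ((WeakDual.eval_continuous (hg.toLp g)).tendsto ℓ).comp hℓ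
    have h2 : ∀ n, D (φ n) (hg.toLp g) = ∫ t, u (φ n) t * g t ∂μ := by
      intro n
      have : D (φ n) (hg.toLp g) = inner ℝ (U (φ n)) (hg.toLp g) := rfl
      rw [this, L2.inner_def]
      refine integral_congr_ae ?_
      filter_upwards [hU (φ n), hg.coeFn_toLp] with t ht1 ht2
      rw [ht1, ht2]
      simp [mul_comm]
    have h3 : ℓ (hg.toLp g) = ∫ t, w t * g t ∂μ := by
      have : ℓ (hg.toLp g) = inner ℝ w (hg.toLp g) := by
        rw [InnerProductSpace.toDual_symm_apply]; rfl
      rw [this, L2.inner_def]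
      refine integral_congr_ae ?_
      filter_upwards [hg.coeFn_toLp] with t ht2
      rw [ht2]
      simp [mul_comm]
    rw [← h3]
    exact h1.congr h2
  have hw1 : Integrable w μ := hw2.integrable one_le_two
  have hu1 : ∀ n, Integrable (u n) μ := fun n => (hmem n).integrable one_le_two
  have hset : ∀ s, MeasurableSet s →
      Tendsto (fun n => ∫ t in s, u (φ n) t ∂μ) atTop (𝓝 (∫ t in s, w t ∂μ)) := by
    intro s hs
    have h := hweak (s.indicator 1) ((memLp_const (1 : ℝ)).indicator hs)
    have h' : ∀ f : ℝ → ℝ, ∫ t, f t * s.indicator 1 t ∂μ = ∫ t in s, f t ∂μ := by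
      intro f
      rw [← integral_indicator hs]
      congr 1
      ext t
      by_cases ht : t ∈ s <;> simp [ht]
    simpa only [h'] using h
  -- Testing against indicators compares the integrals over every measurable set, which passes the
  -- pointwise bounds to the weak limit.
  have hwa : (fun _ => a) ≤ᵐ[μ] w := by
    refine ae_le_of_forall_setIntegral_le (integrable_const a) hw1 fun s hs _ => ?_
    refine ge_of_tendsto' (hset s hs) fun n => ?_
    exact integral_mono_ae (integrable_const a) (hu1 _).integrableOn
      (ae_restrict_of_ae ((hab (φ n)).mono fun t ht => ht.1))
  have hwb : w ≤ᵐ[μ] (fun _ => b) := by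
    refine ae_le_of_forall_setIntegral_le hw1 (integrable_const b) fun s hs _ => ?_
    refine le_of_tendsto' (hset s hs) fun n => ?_
    exact integral_mono_ae (hu1 _).integrableOn (integrable_const b)
      (ae_restrict_of_ae ((hab (φ n)).mono fun t ht => ht.2))
  have hwab : ∀ᵐ t ∂μ, w t ∈ Icc a b := by
    filter_upwards [hwa, hwb] with t h1 h2 using ⟨h1, h2⟩
  refine ⟨φ, hφ, w, hw2.1, hwab, fun g hg => ?_⟩
  have hmul : ∀ {f k : ℝ → ℝ}, AEStronglyMeasurable f μ → (∀ᵐ t ∂μ, f t ∈ Icc a b) →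
      Integrable k μ → Integrable (fun t => f t * k t) μ := fun hf hf' hk =>
    hk.bdd_mul hf (hf'.mono fun t ht => hbd ht)
  have hest : ∀ {f k : ℝ → ℝ}, AEStronglyMeasurable f μ → (∀ᵐ t ∂μ, f t ∈ Icc a b) →
      Integrable k μ → |∫ t, f t * k t ∂μ| ≤ R * ∫ t, ‖k t‖ ∂μ := by
    intro f k hf hf' hk
    rw [← integral_const_mul, ← Real.norm_eq_abs]
    refine norm_integral_le_of_norm_le (hk.norm.const_mul R) (hf'.mono fun t ht => ?_)
    rw [norm_mul]
    exact mul_le_mul_of_nonneg_right (hbd ht) (norm_nonneg _)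
  rw [Metric.tendsto_atTop]
  intro ε hε
  -- From `L²` to `L¹` test functions: `k` is bounded, hence in `L²`, and replacing `g` by `k` costs
  -- at most `ε / 4` for `u (φ n)` and for `w`, leaving `ε / 2` for the convergence against `k`. The
  -- `R + 1` keeps the denominator positive when `R = 0`.
  obtain ⟨k, hksupp, hkε, hkc, hk1⟩ := hg.exists_hasCompactSupport_integral_sub_le
    (ε := ε / (4 * (R + 1))) (by positivity)
  have hk2 : MemLp k 2 μ := by
    obtain ⟨C, hC⟩ := hkc.bounded_above_of_compact_support hksupp
    exact MemLp.of_bound hk1.1 C (ae_of_all _ hC)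
  obtain ⟨n₀, hn₀⟩ := Metric.tendsto_atTop.1 (hweak k hk2) (ε / 2) (by positivity)
  refine ⟨n₀, fun n hn => ?_⟩
  have h1 := hn₀ n hn
  have h2 := hest (hu (φ n)) (hab (φ n)) (hg.sub hk1)
  have h3 := hest hw2.1 hwab (hg.sub hk1)
  have hsmall : R * ∫ t, ‖(g - k) t‖ ∂μ ≤ ε / 4 := by
    calc R * ∫ t, ‖(g - k) t‖ ∂μ ≤ (R + 1) * (ε / (4 * (R + 1))) := by
          refine mul_le_mul (by linarith) hkε (integral_nonneg fun _ => norm_nonneg _)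
            (by linarith)
      _ = ε / 4 := by field_simp
  have hsplit : ∀ {f : ℝ → ℝ}, AEStronglyMeasurable f μ → (∀ᵐ t ∂μ, f t ∈ Icc a b) →
      ∫ t, f t * (g - k) t ∂μ = ∫ t, f t * g t ∂μ - ∫ t, f t * k t ∂μ := by
    intro f hf hf'
    rw [← integral_sub (hmul hf hf' hg) (hmul hf hf' hk1)]
    simp only [Pi.sub_apply, mul_sub]
  rw [hsplit (hu (φ n)) (hab (φ n))] at h2
  rw [hsplit hw2.1 hwab] at h3
  rw [Real.dist_eq] at h1 ⊢
  rw [abs_lt] at h1 ⊢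
  rw [abs_le] at h2 h3
  constructor <;> linarith [h1.1, h1.2, h2.1, h2.2, h3.1, h3.2]

end WeakCompactness

/-! ### Absolutely continuous functions: fundamental theorem of calculus and Grönwall. -/

section AbsolutelyContinuous

open Filter Topology

namespace AbsolutelyContinuousOnInterval

theorem lipschitzWith_comp {X Y : Type*} [PseudoMetricSpace X] [PseudoMetricSpace Y]
    {f : ℝ → X} {a b : ℝ} (hf : AbsolutelyContinuousOnInterval f a b) {L : X → Y} {C : NNReal}
    (hL : LipschitzWith C L) : AbsolutelyContinuousOnInterval (fun t => L (f t)) a b := by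
  have h := Filter.Tendsto.const_mul (C : ℝ) hf
  rw [mul_zero] at h
  refine squeeze_zero (fun _ => Finset.sum_nonneg fun _ _ => dist_nonneg) (fun I => ?_) h
  rw [Finset.mul_sum]
  exact Finset.sum_le_sum fun i _ => hL.dist_le_mul _ _

theorem congr_of_eqOn {X : Type*} [PseudoMetricSpace X] {f g : ℝ → X} {a b : ℝ}
    (hf : AbsolutelyContinuousOnInterval f a b) (hfg : EqOn f g (uIcc a b)) :
    AbsolutelyContinuousOnInterval g a b := by
  refine Filter.Tendsto.congr' ?_ hf
  filter_upwards [mem_inf_of_right (mem_principal_self _)] with I hI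
  exact Finset.sum_congr rfl fun i hi => by
    rw [hfg (hI.1 i hi).1, hfg (hI.1 i hi).2]

theorem finset_sum {ι F : Type*} [SeminormedAddCommGroup F] {a b : ℝ} (s : Finset ι)
    {f : ι → ℝ → F} (hf : ∀ i ∈ s, AbsolutelyContinuousOnInterval (f i) a b) :
    AbsolutelyContinuousOnInterval (fun t => ∑ i ∈ s, f i t) a b := by
  classical
  induction s using Finset.induction_on with
  | empty =>
    simpa using (LipschitzWith.const (0 : F)).lipschitzOnWith.absolutelyContinuousOnInterval
      (a := a) (b := b)
  | insert i s hi ih =>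
    simp only [Finset.sum_insert hi]
    exact (hf i (Finset.mem_insert_self i s)).fun_add
      (ih fun j hj => hf j (Finset.mem_insert_of_mem hj))

theorem re {f : ℝ → ℂ} {a b : ℝ} (hf : AbsolutelyContinuousOnInterval f a b) :
    AbsolutelyContinuousOnInterval (fun t => (f t).re) a b :=
  hf.lipschitzWith_comp Complex.reCLM.lipschitz

theorem im {f : ℝ → ℂ} {a b : ℝ} (hf : AbsolutelyContinuousOnInterval f a b) :
    AbsolutelyContinuousOnInterval (fun t => (f t).im) a b :=
  hf.lipschitzWith_comp Complex.imCLM.lipschitz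

theorem of_re_im {f : ℝ → ℂ} {a b : ℝ}
    (hre : AbsolutelyContinuousOnInterval (fun t => (f t).re) a b)
    (him : AbsolutelyContinuousOnInterval (fun t => (f t).im) a b) :
    AbsolutelyContinuousOnInterval f a b := by
  have h := (hre.lipschitzWith_comp Complex.ofRealCLM.lipschitz).fun_add
    ((him.lipschitzWith_comp Complex.ofRealCLM.lipschitz).const_smul Complex.I)
  refine h.congr_of_eqOn fun t _ => ?_
  simp [mul_comm Complex.I]

/-- Fundamental theorem of calculus for a real function with a prescribed a.e. derivative. -/
theorem integral_eq_sub_of_ae_hasDerivAt {f f' : ℝ → ℝ} {a b : ℝ} (hab : a ≤ b)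
    (hf : AbsolutelyContinuousOnInterval f a b)
    (hf' : ∀ᵐ t ∂volume.restrict (Icc a b), HasDerivAt f (f' t) t) :
    ∫ t in a..b, f' t = f b - f a := by
  rw [← hf.integral_deriv_eq_sub, intervalIntegral.integral_of_le hab,
    intervalIntegral.integral_of_le hab, ← integral_Icc_eq_integral_Ioc,
    ← integral_Icc_eq_integral_Ioc]
  exact integral_congr_ae (hf'.mono fun t ht => ht.deriv.symm)

theorem integral_eq_sub_of_ae_hasDerivAt_complex {f f' : ℝ → ℂ} {a b : ℝ} (hab : a ≤ b)
    (hf : AbsolutelyContinuousOnInterval f a b)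
    (hf' : ∀ᵐ t ∂volume.restrict (Icc a b), HasDerivAt f (f' t) t)
    (hintg : IntervalIntegrable f' volume a b) :
    ∫ t in a..b, f' t = f b - f a := by
  have hre := hf.re.integral_eq_sub_of_ae_hasDerivAt (f' := fun t => (f' t).re) hab
    (hf'.mono fun t ht => Complex.reCLM.hasFDerivAt.comp_hasDerivAt t ht)
  have him := hf.im.integral_eq_sub_of_ae_hasDerivAt (f' := fun t => (f' t).im) hab
    (hf'.mono fun t ht => Complex.imCLM.hasFDerivAt.comp_hasDerivAt t ht)
  have h1 := Complex.reCLM.intervalIntegral_comp_comm hintg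
  have h2 := Complex.imCLM.intervalIntegral_comp_comm hintg
  apply Complex.ext
  · rw [Complex.sub_re, ← hre]; exact h1.symm
  · rw [Complex.sub_im, ← him]; exact h2.symm

/-- Grönwall's inequality for an absolutely continuous function. -/
theorem le_mul_exp_of_ae_hasDerivAt_le {f f' : ℝ → ℝ} {a b C : ℝ}
    (hf : AbsolutelyContinuousOnInterval f a b)
    (hf' : ∀ᵐ t ∂volume.restrict (Icc a b), HasDerivAt f (f' t) t ∧ f' t ≤ C * f t)
    {t : ℝ} (ht : t ∈ Icc a b) : f t ≤ f a * Real.exp (C * (t - a)) := by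
  have hab : a ≤ b := ht.1.trans ht.2
  have hsub : Icc a t ⊆ Icc a b := Icc_subset_Icc_right ht.2
  -- Integrating factor: its product with `f` is absolutely continuous with a nonpositive derivative
  -- almost everywhere, so it does not exceed its initial value.
  have hexp : AbsolutelyContinuousOnInterval (fun s => Real.exp (-C * (s - a))) a t := by
    obtain ⟨K, hK⟩ := ((contDiff_const.mul (contDiff_id.sub contDiff_const)).exp :
      ContDiff ℝ 1 fun s : ℝ => Real.exp (-C * (s - a))).locallyLipschitz.locallyLipschitzOn
        |>.exists_lipschitzOnWith_of_compact (isCompact_uIcc (a := a) (b := t))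
    exact hK.absolutelyContinuousOnInterval
  have hfa : AbsolutelyContinuousOnInterval f a t := hf.mono (by
    rw [uIcc_of_le ht.1, uIcc_of_le hab]; exact hsub)
  have hg := (hfa.fun_mul hexp).integral_eq_sub_of_ae_hasDerivAt ht.1
    (f' := fun s => f' s * Real.exp (-C * (s - a)) +
      f s * (Real.exp (-C * (s - a)) * (-C)))
    ((ae_restrict_of_ae_restrict_of_subset hsub hf').mono fun s hs => by
      refine hs.1.mul ?_
      have h1 : HasDerivAt (fun s : ℝ => -C * (s - a)) (-C) s := by
        simpa using ((hasDerivAt_id s).sub_const a).const_mul (-C)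
      exact h1.exp)
  have hneg : ∫ s in a..t, (f' s * Real.exp (-C * (s - a)) +
      f s * (Real.exp (-C * (s - a)) * (-C))) ≤ 0 := by
    rw [intervalIntegral.integral_of_le ht.1, ← integral_Icc_eq_integral_Ioc]
    refine integral_nonpos_of_ae ?_
    filter_upwards [ae_restrict_of_ae_restrict_of_subset hsub hf'] with s hs
    have : f' s * Real.exp (-C * (s - a)) + f s * (Real.exp (-C * (s - a)) * (-C))
        = (f' s - C * f s) * Real.exp (-C * (s - a)) := by ring
    rw [this]
    exact mul_nonpos_of_nonpos_of_nonneg (by linarith [hs.2]) (Real.exp_pos _).le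
  rw [hg] at hneg
  simp only [sub_self, mul_zero, Real.exp_zero, mul_one] at hneg
  have h1 : f t * Real.exp (-C * (t - a)) ≤ f a := by linarith
  calc f t = f t * Real.exp (-C * (t - a)) * Real.exp (C * (t - a)) := by
        rw [mul_assoc, ← Real.exp_add]; simp
    _ ≤ f a * Real.exp (C * (t - a)) := mul_le_mul_of_nonneg_right h1 (Real.exp_pos _).le

end AbsolutelyContinuousOnInterval

theorem IntervalIntegrable.absolutelyContinuousOnInterval_integral_complex {f : ℝ → ℂ} {a b : ℝ}
    (hf : IntervalIntegrable f volume a b) :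
    AbsolutelyContinuousOnInterval (fun t => ∫ s in a..t, f s) a b := by
  have hsub : ∀ t ∈ uIcc a b, IntervalIntegrable f volume a t := fun t ht =>
    hf.mono_set (uIcc_subset_uIcc_left ht)
  have hre : IntervalIntegrable (fun s => (f s).re) volume a b := ⟨hf.1.re, hf.2.re⟩
  have him : IntervalIntegrable (fun s => (f s).im) volume a b := ⟨hf.1.im, hf.2.im⟩
  refine AbsolutelyContinuousOnInterval.of_re_im
    ((hre.absolutelyContinuousOnInterval_intervalIntegral left_mem_uIcc).congr_of_eqOn
      fun t ht => ?_)
    ((him.absolutelyContinuousOnInterval_intervalIntegral left_mem_uIcc).congr_of_eqOn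
      fun t ht => ?_)
  · exact Complex.reCLM.intervalIntegral_comp_comm (hsub t ht)
  · exact Complex.imCLM.intervalIntegral_comp_comm (hsub t ht)

end AbsolutelyContinuous

/-! ### Frobenius inner product and norm. -/

section Frobenius

variable {N : ℕ}

/-- The real part of the Hilbert–Schmidt inner product. -/
def frobInner (A B : CMat N) : ℝ :=
  ∑ i, ∑ j, ((A i j).re * (B i j).re + (A i j).im * (B i j).im)

/-- The square of the Frobenius norm. -/
def frobSq (A : CMat N) : ℝ := frobInner A A

theorem frobInner_eq_re_trace (A B : CMat N) : frobInner A B = (Aᴴ * B).trace.re := by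
  simp only [frobInner, Matrix.trace, Matrix.diag, Matrix.mul_apply, Matrix.conjTranspose_apply,
    Complex.re_sum]
  rw [Finset.sum_comm]
  refine Finset.sum_congr rfl fun i _ => Finset.sum_congr rfl fun j _ => ?_
  simp [Complex.mul_re]

theorem frobInner_smul_right (c : ℝ) (A B : CMat N) :
    frobInner A ((c : ℂ) • B) = c * frobInner A B := by
  simp only [frobInner, Finset.mul_sum, Matrix.smul_apply, smul_eq_mul, Complex.re_ofReal_mul,
    Complex.im_ofReal_mul]
  refine Finset.sum_congr rfl fun i _ => Finset.sum_congr rfl fun j _ => ?_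
  ring

theorem frobInner_add_right (A B C : CMat N) :
    frobInner A (B + C) = frobInner A B + frobInner A C := by
  simp only [frobInner, ← Finset.sum_add_distrib, Matrix.add_apply, Complex.add_re, Complex.add_im]
  refine Finset.sum_congr rfl fun i _ => Finset.sum_congr rfl fun j _ => ?_
  ring

theorem frobSq_eq_sum (A : CMat N) : frobSq A = ∑ i, ∑ j, ‖A i j‖ ^ 2 := by
  simp only [frobSq, frobInner]
  refine Finset.sum_congr rfl fun i _ => Finset.sum_congr rfl fun j _ => ?_
  rw [← Complex.normSq_eq_norm_sq, Complex.normSq_apply]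

theorem frobSq_nonneg (A : CMat N) : 0 ≤ frobSq A := by
  rw [frobSq_eq_sum]
  exact Finset.sum_nonneg fun i _ => Finset.sum_nonneg fun j _ => sq_nonneg _

theorem norm_entry_sq_le_frobSq (A : CMat N) (i j : Fin N) : ‖A i j‖ ^ 2 ≤ frobSq A := by
  rw [frobSq_eq_sum]
  calc ‖A i j‖ ^ 2 ≤ ∑ j, ‖A i j‖ ^ 2 :=
        Finset.single_le_sum (f := fun j => ‖A i j‖ ^ 2) (fun _ _ => sq_nonneg _)
          (Finset.mem_univ j)
    _ ≤ _ := Finset.single_le_sum (f := fun i => ∑ j, ‖A i j‖ ^ 2)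
          (fun _ _ => Finset.sum_nonneg fun _ _ => sq_nonneg _) (Finset.mem_univ i)

theorem norm_entry_le_sqrt_frobSq (A : CMat N) (i j : Fin N) : ‖A i j‖ ≤ √(frobSq A) :=
  Real.le_sqrt_of_sq_le (norm_entry_sq_le_frobSq A i j)

theorem continuous_frobSq : Continuous (frobSq : CMat N → ℝ) := by
  unfold frobSq frobInner
  fun_prop

theorem eq_zero_of_frobSq_nonpos {A : CMat N} (h : frobSq A ≤ 0) : A = 0 := by
  ext i j
  have := (norm_entry_sq_le_frobSq A i j).trans h
  simpa using le_antisymm this (sq_nonneg _)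

/-- Each entry contributes at most `c * frobSq A`, and `N * N` counts the entries. Only some
constant is needed, to bound the dissipator as a quadratic form. -/
theorem frobInner_le (A B : CMat N) {c : ℝ}
    (hB : ∀ i j, ‖B i j‖ ≤ c * √(frobSq A)) : frobInner A B ≤ (N * N * c) * frobSq A := by
  have h : ∀ i j, (A i j).re * (B i j).re + (A i j).im * (B i j).im ≤ c * frobSq A := by
    intro i j
    have h1 : (A i j).re * (B i j).re + (A i j).im * (B i j).im
        = (star (A i j) * B i j).re := by simp [Complex.mul_re]
    calc (A i j).re * (B i j).re + (A i j).im * (B i j).im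
        ≤ ‖star (A i j) * B i j‖ := by rw [h1]; exact Complex.re_le_norm _
      _ = ‖A i j‖ * ‖B i j‖ := by rw [norm_mul, norm_star]
      _ ≤ √(frobSq A) * (c * √(frobSq A)) :=
          mul_le_mul (norm_entry_le_sqrt_frobSq A i j) (hB i j) (norm_nonneg _)
            (Real.sqrt_nonneg _)
      _ = c * frobSq A := by
          rw [mul_left_comm, Real.mul_self_sqrt (frobSq_nonneg A)]
  calc frobInner A B ≤ ∑ _i : Fin N, ∑ _j : Fin N, c * frobSq A :=
        Finset.sum_le_sum fun i _ => Finset.sum_le_sum fun j _ => h i j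
    _ = _ := by simp; ring

theorem trace_im_eq_zero_of_isHermitian {A : CMat N} (hA : A.IsHermitian) : A.trace.im = 0 := by
  have h : star A.trace = A.trace := by rw [← Matrix.trace_conjTranspose, hA.eq]
  exact Complex.conj_eq_iff_im.1 h

theorem trace_mul_im_eq_zero {A B : CMat N} (hA : A.IsHermitian) (hB : B.IsHermitian) :
    (A * B).trace.im = 0 := by
  have h : star (A * B).trace = (A * B).trace := by
    rw [← Matrix.trace_conjTranspose, Matrix.conjTranspose_mul, hA.eq, hB.eq, Matrix.trace_mul_comm]
  exact Complex.conj_eq_iff_im.1 h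

end Frobenius

/-! ### The Lindblad vector field: linearity, symmetry and growth. -/

section VectorField

variable {N K : ℕ}

/-- The Hamiltonian part `-(i/ℏ) [H, ρ]` of the Lindblad equation. -/
noncomputable def hamFlow (hbar : ℝ) (H ρ : CMat N) : CMat N :=
  (-(Complex.I / (hbar : ℂ))) • ⁅H, ρ⁆

/-- The traces of `ρᴴ H ρ` and `ρᴴ ρ H` are real and the prefactor is purely imaginary.
Infinitesimally, unitary evolution preserves the Frobenius norm. -/
theorem frobInner_hamFlow (hbar : ℝ) {H : CMat N} (hH : H.IsHermitian) (ρ : CMat N) :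
    frobInner ρ (hamFlow hbar H ρ) = 0 := by
  have h1 : (ρᴴ * (H * ρ)).trace.im = 0 := by
    refine trace_im_eq_zero_of_isHermitian ?_
    rw [← mul_assoc]
    exact Matrix.isHermitian_conjTranspose_mul_mul ρ hH
  have h2 : (ρᴴ * (ρ * H)).trace.im = 0 := by
    rw [← mul_assoc]
    exact trace_mul_im_eq_zero (Matrix.isHermitian_conjTranspose_mul_self ρ) hH
  rw [frobInner_eq_re_trace, hamFlow, Ring.lie_def, Matrix.mul_smul, Matrix.trace_smul, mul_sub,
    Matrix.trace_sub, smul_eq_mul, Complex.mul_re, Complex.sub_im, h1, h2]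
  have h3 : (-(Complex.I / (hbar : ℂ))).re = 0 := by
    simp [Complex.div_re]
  rw [h3]
  simp

theorem hamFlow_add_left (hbar : ℝ) (H H' ρ : CMat N) :
    hamFlow hbar (H + H') ρ = hamFlow hbar H ρ + hamFlow hbar H' ρ := by
  simp only [hamFlow, Ring.lie_def, add_mul, mul_add]
  module

theorem hamFlow_smul_left (hbar : ℝ) (c : ℂ) (H ρ : CMat N) :
    hamFlow hbar (c • H) ρ = c • hamFlow hbar H ρ := by
  simp only [hamFlow, Ring.lie_def, Matrix.smul_mul, Matrix.mul_smul]
  module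

theorem hamFlow_smul_right (hbar : ℝ) (c : ℂ) (H ρ : CMat N) :
    hamFlow hbar H (c • ρ) = c • hamFlow hbar H ρ := by
  simp only [hamFlow, Ring.lie_def, Matrix.smul_mul, Matrix.mul_smul]
  module

theorem hamFlow_sub_right (hbar : ℝ) (H ρ σ : CMat N) :
    hamFlow hbar H (ρ - σ) = hamFlow hbar H ρ - hamFlow hbar H σ := by
  simp only [hamFlow, Ring.lie_def, sub_mul, mul_sub]
  module

theorem conjTranspose_hamFlow (hbar : ℝ) {H : CMat N} (hH : H.IsHermitian) (ρ : CMat N) :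
    (hamFlow hbar H ρ)ᴴ = hamFlow hbar H ρᴴ := by
  rw [hamFlow, hamFlow, Ring.lie_def, Ring.lie_def, Matrix.conjTranspose_smul,
    Matrix.conjTranspose_sub, Matrix.conjTranspose_mul, Matrix.conjTranspose_mul, hH.eq]
  have : star (-(Complex.I / (hbar : ℂ))) = Complex.I / (hbar : ℂ) := by
    simp [neg_div]
  rw [this, neg_smul, ← smul_neg, neg_sub]

theorem Continuous.hamFlow {X : Type*} [TopologicalSpace X] {f g : X → CMat N}
    (hf : Continuous f) (hg : Continuous g) (hbar : ℝ) :
    Continuous fun x => hamFlow hbar (f x) (g x) := by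
  simp only [_root_.hamFlow, Ring.lie_def]
  fun_prop

theorem continuous_hamFlow (hbar : ℝ) :
    Continuous fun p : CMat N × CMat N => hamFlow hbar p.1 p.2 :=
  continuous_fst.hamFlow continuous_snd hbar

/-- The crude sum over all entries of `H` is chosen because it is integrable in time as soon as the
entries of `H_c` are. -/
theorem norm_hamFlow_entry_le {hbar : ℝ} (hpos : 0 < hbar) (H ρ : CMat N) {R : ℝ}
    (hρ : ∀ i j, ‖ρ i j‖ ≤ R) (i j : Fin N) :
    ‖hamFlow hbar H ρ i j‖ ≤ 2 * R / hbar * ∑ k, ∑ l, ‖H k l‖ := by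
  have hR : 0 ≤ R := (norm_nonneg _).trans (hρ i j)
  have h1 : ‖(H * ρ) i j‖ ≤ R * ∑ k, ∑ l, ‖H k l‖ := by
    calc ‖(H * ρ) i j‖ ≤ ∑ l, ‖H i l‖ * R := by
          rw [Matrix.mul_apply]
          refine norm_sum_le_of_le _ fun l _ => ?_
          rw [norm_mul]
          exact mul_le_mul_of_nonneg_left (hρ l j) (norm_nonneg _)
      _ = R * ∑ l, ‖H i l‖ := by rw [← Finset.sum_mul, mul_comm]
      _ ≤ _ := mul_le_mul_of_nonneg_left
          (Finset.single_le_sum (f := fun k => ∑ l, ‖H k l‖)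
            (fun _ _ => Finset.sum_nonneg fun _ _ => norm_nonneg _) (Finset.mem_univ i)) hR
  have h2 : ‖(ρ * H) i j‖ ≤ R * ∑ k, ∑ l, ‖H k l‖ := by
    calc ‖(ρ * H) i j‖ ≤ ∑ k, R * ‖H k j‖ := by
          rw [Matrix.mul_apply]
          refine norm_sum_le_of_le _ fun l _ => ?_
          rw [norm_mul]
          exact mul_le_mul_of_nonneg_right (hρ i l) (norm_nonneg _)
      _ = R * ∑ k, ‖H k j‖ := by rw [← Finset.mul_sum]
      _ ≤ _ := mul_le_mul_of_nonneg_left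
          (Finset.sum_le_sum fun k _ => Finset.single_le_sum (f := fun l => ‖H k l‖)
            (fun _ _ => norm_nonneg _) (Finset.mem_univ j)) hR
  have h3 : ‖-(Complex.I / (hbar : ℂ))‖ = 1 / hbar := by
    simp [abs_of_pos hpos]
  rw [hamFlow, Matrix.smul_apply, smul_eq_mul, norm_mul, h3, Ring.lie_def, Matrix.sub_apply]
  calc 1 / hbar * ‖(H * ρ) i j - (ρ * H) i j‖
      ≤ 1 / hbar * (R * ∑ k, ∑ l, ‖H k l‖ + R * ∑ k, ∑ l, ‖H k l‖) :=
        mul_le_mul_of_nonneg_left ((norm_sub_le _ _).trans (add_le_add h1 h2)) (by positivity)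
    _ = _ := by ring

namespace OpenSystem

variable (S : OpenSystem N K)

theorem isLinearMap_dissipator : IsLinearMap ℂ S.dissipator where
  map_add ρ σ := by
    simp only [dissipator, ← Finset.sum_add_distrib, ← smul_add]
    refine Finset.sum_congr rfl fun k _ => ?_
    congr 1
    simp only [mul_add, add_mul, smul_add]
    abel
  map_smul c ρ := by
    simp only [dissipator, Finset.smul_sum]
    refine Finset.sum_congr rfl fun k _ => ?_
    rw [smul_comm c]
    congr 1
    simp only [Matrix.mul_smul, Matrix.smul_mul, smul_sub, smul_add, smul_comm c]

theorem conjTranspose_dissipator (ρ : CMat N) : (S.dissipator ρ)ᴴ = S.dissipator ρᴴ := by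
  simp only [dissipator, Matrix.conjTranspose_sum, Matrix.conjTranspose_smul]
  refine Finset.sum_congr rfl fun k _ => ?_
  simp only [Matrix.conjTranspose_sub, Matrix.conjTranspose_add, Matrix.conjTranspose_smul,
    Matrix.conjTranspose_mul, Matrix.conjTranspose_conjTranspose, mul_assoc]
  have h1 : star (S.γ k : ℂ) = S.γ k := Complex.conj_ofReal _
  have h2 : star (1 / 2 : ℂ) = 1 / 2 := by simp
  rw [h1, h2, add_comm (ρᴴ * _)]

theorem continuous_dissipator : Continuous S.dissipator := by
  unfold dissipator
  fun_prop

theorem rhs_eq (t v : ℝ) (ρ : CMat N) :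
    S.rhs t v ρ = hamFlow S.hbar S.H₀ ρ + S.dissipator ρ + (v : ℂ) • hamFlow S.hbar (S.Hc t) ρ := by
  have : S.rhs t v ρ = hamFlow S.hbar (S.H₀ + (v : ℂ) • S.Hc t) ρ + S.dissipator ρ := rfl
  rw [this, hamFlow_add_left, hamFlow_smul_left]
  abel

/-- The uncontrolled part of the Lindblad equation. -/
noncomputable def freeFlow (ρ : CMat N) : CMat N := hamFlow S.hbar S.H₀ ρ + S.dissipator ρ

theorem rhs_eq_freeFlow_add (t v : ℝ) (ρ : CMat N) :
    S.rhs t v ρ = S.freeFlow ρ + (v : ℂ) • hamFlow S.hbar (S.Hc t) ρ := S.rhs_eq t v ρ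

theorem continuous_freeFlow : Continuous S.freeFlow :=
  (continuous_const.hamFlow continuous_id S.hbar).add S.continuous_dissipator

/-- Homogeneity turns a retraction of the state by a scalar into a damping of the vector field, the
form covered by the energy estimate. -/
theorem rhs_smul (t v : ℝ) (c : ℂ) (ρ : CMat N) : S.rhs t v (c • ρ) = c • S.rhs t v ρ := by
  simp only [rhs_eq, hamFlow_smul_right, S.isLinearMap_dissipator.map_smul, smul_add,
    smul_comm c (v : ℂ)]

theorem rhs_sub (t v : ℝ) (ρ σ : CMat N) :
    S.rhs t v (ρ - σ) = S.rhs t v ρ - S.rhs t v σ := by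
  simp only [rhs_eq, hamFlow_sub_right, S.isLinearMap_dissipator.map_sub, smul_sub]
  abel

theorem conjTranspose_rhs (t v : ℝ) (ρ : CMat N) : (S.rhs t v ρ)ᴴ = S.rhs t v ρᴴ := by
  simp only [rhs_eq, Matrix.conjTranspose_add, Matrix.conjTranspose_smul,
    conjTranspose_hamFlow _ S.H₀_herm, conjTranspose_hamFlow _ (S.Hc_herm t),
    conjTranspose_dissipator]
  have h1 : star (v : ℂ) = v := Complex.conj_ofReal _
  rw [h1]

/-- The dissipator is dominated by the Frobenius norm. -/
theorem exists_frobInner_dissipator_le :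
    ∃ C : ℝ, 0 ≤ C ∧ ∀ ρ : CMat N, frobInner ρ (S.dissipator ρ) ≤ C * frobSq ρ := by
  -- Matrices are read as functions, which carry the supremum norm, so that the operator norm is
  -- available.
  let D : (Fin N → Fin N → ℂ) →ₗ[ℂ] (Fin N → Fin N → ℂ) := S.isLinearMap_dissipator.mk' _
  let D' := LinearMap.toContinuousLinearMap D
  refine ⟨N * N * ‖D'‖, by positivity, fun ρ => frobInner_le _ _ fun i j => ?_⟩
  let x : Fin N → Fin N → ℂ := ρ
  have h1 : ‖D' x‖ ≤ ‖D'‖ * ‖x‖ := D'.le_opNorm x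
  have h2 : ‖x‖ ≤ √(frobSq ρ) := by
    refine (pi_norm_le_iff_of_nonneg (Real.sqrt_nonneg _)).2 fun i => ?_
    exact (pi_norm_le_iff_of_nonneg (Real.sqrt_nonneg _)).2 fun j =>
      norm_entry_le_sqrt_frobSq ρ i j
  have h3 : ‖S.dissipator ρ i j‖ ≤ ‖D' x‖ :=
    (norm_le_pi_norm (D' x i) j).trans (norm_le_pi_norm (D' x) i)
  exact h3.trans (h1.trans (mul_le_mul_of_nonneg_left h2 (norm_nonneg _)))

/-- The control drops out, which makes the a priori bound on trajectories, and later `M`,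
independent of `Ω`. -/
theorem frobInner_rhs (t v : ℝ) (ρ : CMat N) :
    frobInner ρ (S.rhs t v ρ) = frobInner ρ (S.dissipator ρ) := by
  rw [rhs_eq, frobInner_add_right, frobInner_add_right, frobInner_smul_right,
    frobInner_hamFlow _ S.H₀_herm, frobInner_hamFlow _ (S.Hc_herm t)]
  ring

/-- A bound for the free flow on bounded sets of matrices. -/
theorem exists_norm_freeFlow_entry_le (R : ℝ) :
    ∃ A : ℝ, 0 ≤ A ∧ ∀ ρ : CMat N, (∀ i j, ‖ρ i j‖ ≤ R) → ∀ i j, ‖S.freeFlow ρ i j‖ ≤ A := by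
  let F : (Fin N → Fin N → ℂ) → (Fin N → Fin N → ℂ) := S.freeFlow
  have hc : Continuous F := S.continuous_freeFlow
  obtain ⟨A, hA⟩ := (isCompact_closedBall (0 : Fin N → Fin N → ℂ) R).exists_bound_of_continuousOn
    hc.continuousOn
  refine ⟨max A 0, le_max_right _ _, fun ρ hρ i j => ?_⟩
  have hR : 0 ≤ R := (norm_nonneg _).trans (hρ i j)
  let x : Fin N → Fin N → ℂ := ρ
  have hmem : x ∈ Metric.closedBall (0 : Fin N → Fin N → ℂ) R := by
    rw [mem_closedBall_zero_iff]
    exact (pi_norm_le_iff_of_nonneg hR).2 fun i => (pi_norm_le_iff_of_nonneg hR).2 fun j => hρ i j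
  refine le_max_of_le_left (le_trans ?_ (hA x hmem))
  exact (norm_le_pi_norm (F x i) j).trans (norm_le_pi_norm (F x) i)

end OpenSystem

end VectorField

/-! ### Derivatives of the Frobenius norm and of the coherence along curves. -/

section Calculus

open Filter Topology

variable {N K : ℕ}

theorem absolutelyContinuousOnInterval_and_hasDerivAt_of_integral_eq {f g : ℝ → ℂ} {a b : ℝ} {c : ℂ}
    (hab : a ≤ b) (hg : IntegrableOn g (Icc a b))
    (h : ∀ t ∈ Icc a b, f t = c + ∫ s in a..t, g s) :
    AbsolutelyContinuousOnInterval f a b ∧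
      ∀ᵐ t ∂volume.restrict (Icc a b), HasDerivAt f (g t) t := by
  have hgi : IntervalIntegrable g volume a b :=
    (intervalIntegrable_iff_integrableOn_Icc_of_le hab).2 hg
  constructor
  · refine ((LipschitzWith.const c).lipschitzOnWith.absolutelyContinuousOnInterval.fun_add
      hgi.absolutelyContinuousOnInterval_integral_complex).congr_of_eqOn fun t ht => ?_
    rw [uIcc_of_le hab] at ht
    exact (h t ht).symm
  -- The derivative is two-sided while the equation holds only on `[a, b]`, so the endpoints are
  -- discarded as a null set.
  · rw [← Measure.restrict_congr_set Ioo_ae_eq_Icc, ae_restrict_iff' measurableSet_Ioo]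
    filter_upwards [hgi.ae_hasDerivAt_integral] with t ht hmem
    rw [uIcc_of_le hab] at ht
    refine ((ht (Ioo_subset_Icc_self hmem) a (left_mem_Icc.2 hab)).const_add c).congr_of_eventuallyEq
      ?_
    filter_upwards [Ioo_mem_nhds hmem.1 hmem.2] with s hs using h s (Ioo_subset_Icc_self hs)

theorem hasDerivAt_frobSq {σ : ℝ → CMat N} {X : CMat N} {t : ℝ}
    (h : ∀ i j, HasDerivAt (fun s => σ s i j) (X i j) t) :
    HasDerivAt (fun s => frobSq (σ s)) (2 * frobInner (σ t) X) t := by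
  have hre : ∀ i j, HasDerivAt (fun s => (σ s i j).re) (X i j).re t := fun i j =>
    Complex.reCLM.hasFDerivAt.comp_hasDerivAt t (h i j)
  have him : ∀ i j, HasDerivAt (fun s => (σ s i j).im) (X i j).im t := fun i j =>
    Complex.imCLM.hasFDerivAt.comp_hasDerivAt t (h i j)
  have := HasDerivAt.fun_sum (u := Finset.univ) fun i _ =>
    HasDerivAt.fun_sum (u := Finset.univ) fun j _ =>
      (((hre i j).mul (hre i j)).add ((him i j).mul (him i j)))
  refine this.congr_deriv ?_
  simp only [frobInner, Finset.mul_sum]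
  refine Finset.sum_congr rfl fun i _ => Finset.sum_congr rfl fun j _ => ?_
  ring

theorem absolutelyContinuousOnInterval_frobSq {σ : ℝ → CMat N} {a b : ℝ}
    (h : ∀ i j, AbsolutelyContinuousOnInterval (fun s => σ s i j) a b) :
    AbsolutelyContinuousOnInterval (fun s => frobSq (σ s)) a b := by
  unfold frobSq frobInner
  refine AbsolutelyContinuousOnInterval.finset_sum (F := ℝ) Finset.univ fun i _ => ?_
  refine AbsolutelyContinuousOnInterval.finset_sum (F := ℝ) Finset.univ fun j _ => ?_
  have h1 := (h i j).re.fun_mul (h i j).re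
  have h2 := (h i j).im.fun_mul (h i j).im
  exact h1.fun_add h2

theorem expVal_eq_sum (ρ A : CMat N) : expVal ρ A = ∑ i, ∑ j, ρ i j * A j i := by
  simp [expVal, Matrix.trace, Matrix.mul_apply]

theorem hasDerivAt_re_expVal {ρ : ℝ → CMat N} {X : CMat N} {t : ℝ}
    (h : ∀ i j, HasDerivAt (fun s => ρ s i j) (X i j) t) (A : CMat N) :
    HasDerivAt (fun s => (expVal (ρ s) A).re) (expVal X A).re t := by
  simp only [expVal_eq_sum]
  exact Complex.reCLM.hasFDerivAt.comp_hasDerivAt t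
    (HasDerivAt.fun_sum fun i _ => HasDerivAt.fun_sum fun j _ => (h i j).mul_const (A j i))

theorem absolutelyContinuousOnInterval_re_expVal {ρ : ℝ → CMat N} {a b : ℝ}
    (h : ∀ i j, AbsolutelyContinuousOnInterval (fun s => ρ s i j) a b) (A : CMat N) :
    AbsolutelyContinuousOnInterval (fun s => (expVal (ρ s) A).re) a b := by
  simp only [expVal_eq_sum]
  refine AbsolutelyContinuousOnInterval.re ?_
  refine AbsolutelyContinuousOnInterval.finset_sum _ fun i _ =>
    AbsolutelyContinuousOnInterval.finset_sum _ fun j _ => ?_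
  simpa [mul_comm] using (h i j).const_smul (A j i)

/-- The derivative of `C²` at `ρ` in the direction `X`. -/
noncomputable def coherenceDeriv (ρ X : CMat N) : ℝ :=
  ∑ p ∈ levelPairs N,
    (2 * ((expVal ρ (deltaRe p.1 p.2)).re * (expVal X (deltaRe p.1 p.2)).re)
      + 2 * ((expVal ρ (deltaIm p.1 p.2)).re * (expVal X (deltaIm p.1 p.2)).re))

theorem coherence_sq (ρ : CMat N) : coherence ρ ^ 2 = ∑ p ∈ levelPairs N,
    ((expVal ρ (deltaRe p.1 p.2)).re ^ 2 + (expVal ρ (deltaIm p.1 p.2)).re ^ 2) :=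
  Real.sq_sqrt (Finset.sum_nonneg fun _ _ => by positivity)

theorem hasDerivAt_coherence_sq {ρ : ℝ → CMat N} {X : CMat N} {t : ℝ}
    (h : ∀ i j, HasDerivAt (fun s => ρ s i j) (X i j) t) :
    HasDerivAt (fun s => coherence (ρ s) ^ 2) (coherenceDeriv (ρ t) X) t := by
  simp only [coherence_sq]
  refine HasDerivAt.fun_sum fun p _ => ?_
  refine (((hasDerivAt_re_expVal h (deltaRe p.1 p.2)).pow 2).add
    ((hasDerivAt_re_expVal h (deltaIm p.1 p.2)).pow 2)).congr_deriv ?_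
  simp only [Nat.cast_ofNat, Nat.add_one_sub_one, pow_one]
  ring

theorem absolutelyContinuousOnInterval_coherence_sq {ρ : ℝ → CMat N} {a b : ℝ}
    (h : ∀ i j, AbsolutelyContinuousOnInterval (fun s => ρ s i j) a b) :
    AbsolutelyContinuousOnInterval (fun s => coherence (ρ s) ^ 2) a b := by
  simp only [coherence_sq]
  refine AbsolutelyContinuousOnInterval.finset_sum (F := ℝ) (levelPairs N) fun p _ => ?_
  have h1 := absolutelyContinuousOnInterval_re_expVal h (deltaRe p.1 p.2)
  have h2 := absolutelyContinuousOnInterval_re_expVal h (deltaIm p.1 p.2)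
  simpa only [sq] using (h1.fun_mul h1).fun_add (h2.fun_mul h2)

theorem continuous_coherence_sq : Continuous fun ρ : CMat N => coherence ρ ^ 2 := by
  simp only [coherence_sq, expVal]
  fun_prop

theorem Continuous.coherenceDeriv {X : Type*} [TopologicalSpace X] {f g : X → CMat N}
    (hf : Continuous f) (hg : Continuous g) : Continuous fun x => coherenceDeriv (f x) (g x) := by
  simp only [_root_.coherenceDeriv, expVal]
  fun_prop

theorem coherenceDeriv_add_right (ρ X Y : CMat N) :
    coherenceDeriv ρ (X + Y) = coherenceDeriv ρ X + coherenceDeriv ρ Y := by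
  simp only [coherenceDeriv, ← Finset.sum_add_distrib, expVal, add_mul, Matrix.trace_add,
    Complex.add_re]
  refine Finset.sum_congr rfl fun p _ => ?_
  ring

theorem coherenceDeriv_smul_right (ρ X : CMat N) (v : ℝ) :
    coherenceDeriv ρ ((v : ℂ) • X) = v * coherenceDeriv ρ X := by
  simp only [coherenceDeriv, Finset.mul_sum, expVal, Matrix.smul_mul, Matrix.trace_smul,
    smul_eq_mul, Complex.re_ofReal_mul]
  refine Finset.sum_congr rfl fun p _ => ?_
  ring

theorem isHermitian_deltaRe (j k : Fin N) : (deltaRe j k).IsHermitian := by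
  simp [Matrix.IsHermitian, deltaRe, Matrix.conjTranspose_add, add_comm]

theorem isHermitian_deltaIm (j k : Fin N) : (deltaIm j k).IsHermitian := by
  simp [Matrix.IsHermitian, deltaIm, Matrix.conjTranspose_add, add_comm]

theorem ofReal_re_expVal {ρ A : CMat N} (hρ : ρ.IsHermitian) (hA : A.IsHermitian) :
    ((expVal ρ A).re : ℂ) = expVal ρ A :=
  Complex.ext rfl (by rw [Complex.ofReal_im]; exact (trace_mul_im_eq_zero hρ hA).symm)

/-- Cyclicity of the trace moves the commutator from the state to the observable; this produces the
commutators in `Phi`. -/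
theorem expVal_hamFlow (hbar : ℝ) (H ρ A : CMat N) :
    expVal (hamFlow hbar H ρ) A = -(Complex.I / hbar) * expVal ρ ⁅A, H⁆ := by
  simp only [expVal, hamFlow, Ring.lie_def, Matrix.smul_mul, Matrix.trace_smul, sub_mul, mul_sub,
    Matrix.trace_sub, smul_eq_mul]
  rw [mul_assoc H ρ A, Matrix.trace_mul_comm H, mul_assoc, mul_assoc]

/-- For Hermitian matrices `Φ` is `ℏ` times the derivative of `C²` along the control field. -/
theorem Phi_eq_coherenceDeriv {hbar : ℝ} (hpos : 0 < hbar) {H ρ : CMat N} (hH : H.IsHermitian)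
    (hρ : ρ.IsHermitian) :
    Phi H ρ = ((hbar * coherenceDeriv ρ (hamFlow hbar H ρ) : ℝ) : ℂ) := by
  have hX : (hamFlow hbar H ρ).IsHermitian := by
    rw [Matrix.IsHermitian, conjTranspose_hamFlow hbar hH, hρ.eq]
  have h0 : (hbar : ℂ) ≠ 0 := by exact_mod_cast hpos.ne'
  simp only [Phi, coherenceDeriv]
  push_cast
  rw [Finset.mul_sum, Finset.mul_sum]
  refine Finset.sum_congr rfl fun p _ => ?_
  rw [ofReal_re_expVal hρ (isHermitian_deltaRe _ _), ofReal_re_expVal hρ (isHermitian_deltaIm _ _),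
    ofReal_re_expVal hX (isHermitian_deltaRe _ _), ofReal_re_expVal hX (isHermitian_deltaIm _ _),
    expVal_hamFlow, expVal_hamFlow]
  field_simp
  ring

end Calculus

/-! ### A priori bounds for trajectories and the integral form of the equation. -/

section Trajectories

open Filter Topology

variable {N K : ℕ}

theorem aestronglyMeasurable_matrix {μ : Measure ℝ} {A : ℝ → CMat N}
    (h : ∀ i j, AEStronglyMeasurable (fun t => A t i j) μ) : AEStronglyMeasurable A μ := by
  let B : ℝ → Fin N → Fin N → ℂ := A
  have : AEStronglyMeasurable B μ :=
    (aemeasurable_pi_lambda _ fun i => aemeasurable_pi_lambda _ fun j =>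
      (h i j).aemeasurable).aestronglyMeasurable
  exact this

theorem continuousOn_matrix {s : Set ℝ} {A : ℝ → CMat N}
    (h : ∀ i j, ContinuousOn (fun t => A t i j) s) : ContinuousOn A s :=
  continuousOn_pi.2 fun i => continuousOn_pi.2 fun j => h i j

theorem ContinuousOn.aestronglyMeasurable_matrix {a b : ℝ} {A : ℝ → CMat N}
    (h : ContinuousOn A (Icc a b)) : AEStronglyMeasurable A (volume.restrict (Icc a b)) := by
  refine _root_.aestronglyMeasurable_matrix fun i j => ?_
  have h1 : ContinuousOn (fun t => A t i j) (Icc a b) :=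
    (continuous_id.matrix_elem i j).comp_continuousOn h
  exact h1.aestronglyMeasurable measurableSet_Icc

namespace OpenSystem

variable (S : OpenSystem N K)

/-- The energy estimate. The factor `c` covers time-dependent damping of the vector field. -/
theorem frobSq_le_of_ae_hasDerivAt {C : ℝ} (hC0 : 0 ≤ C)
    (hC : ∀ ρ : CMat N, frobInner ρ (S.dissipator ρ) ≤ C * frobSq ρ) {σ : ℝ → CMat N} {a b : ℝ}
    (hac : ∀ i j, AbsolutelyContinuousOnInterval (fun s => σ s i j) a b)
    (hd : ∀ᵐ t ∂volume.restrict (Icc a b), ∃ v c : ℝ, 0 ≤ c ∧ c ≤ 1 ∧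
      ∀ i j, HasDerivAt (fun s => σ s i j) (((c : ℂ) • S.rhs t v (σ t)) i j) t)
    {t : ℝ} (ht : t ∈ Icc a b) :
    frobSq (σ t) ≤ frobSq (σ a) * Real.exp (2 * C * (b - a)) := by
  have h := (absolutelyContinuousOnInterval_frobSq hac).le_mul_exp_of_ae_hasDerivAt_le
    (f' := deriv fun s => frobSq (σ s)) (C := 2 * C)
    (hd.mono fun s ⟨v, c, hc0, hc1, hs⟩ => by
      have h1 := hasDerivAt_frobSq hs
      refine ⟨h1.differentiableAt.hasDerivAt, ?_⟩
      rw [h1.deriv, frobInner_smul_right, frobInner_rhs]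
      have h2 : c * frobInner (σ s) (S.dissipator (σ s)) ≤ c * (C * frobSq (σ s)) :=
        mul_le_mul_of_nonneg_left (hC _) hc0
      have h3 : c * (C * frobSq (σ s)) ≤ 1 * (C * frobSq (σ s)) :=
        mul_le_mul_of_nonneg_right hc1 (mul_nonneg hC0 (frobSq_nonneg _))
      linarith) ht
  refine h.trans (mul_le_mul_of_nonneg_left (Real.exp_le_exp.2 ?_) (frobSq_nonneg _))
  exact mul_le_mul_of_nonneg_left (by linarith [ht.2]) (by positivity)

variable {S} {t₀ tf : ℝ} {ρ₀ : CMat N} {u : ℝ → ℝ} {ρ : ℝ → CMat N}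

theorem IsTrajectory.continuousOn (h : S.IsTrajectory t₀ tf ρ₀ u ρ) (ht : t₀ ≤ tf) :
    ContinuousOn ρ (Icc t₀ tf) :=
  continuousOn_matrix fun i j => by simpa [uIcc_of_le ht] using (h.2.1 i j).continuousOn

theorem IsTrajectory.frobSq_le (h : S.IsTrajectory t₀ tf ρ₀ u ρ) {C : ℝ} (hC0 : 0 ≤ C)
    (hC : ∀ ρ : CMat N, frobInner ρ (S.dissipator ρ) ≤ C * frobSq ρ) {t : ℝ}
    (ht : t ∈ Icc t₀ tf) : frobSq (ρ t) ≤ frobSq ρ₀ * Real.exp (2 * C * (tf - t₀)) := by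
  rw [← h.1]
  refine S.frobSq_le_of_ae_hasDerivAt hC0 hC h.2.1 (h.2.2.mono fun s hs => ?_) ht
  exact ⟨u s, 1, zero_le_one, le_rfl, by simpa using hs⟩

/-- Trajectories from a Hermitian initial state are Hermitian. -/
theorem IsTrajectory.isHermitian (h : S.IsTrajectory t₀ tf ρ₀ u ρ) (hρ₀ : ρ₀.IsHermitian) {t : ℝ}
    (ht : t ∈ Icc t₀ tf) : (ρ t).IsHermitian := by
  obtain ⟨C, hC0, hC⟩ := S.exists_frobInner_dissipator_le
  -- The difference `ρ - ρᴴ` solves the same linear equation with initial value zero, so the energy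
  -- estimate makes it vanish.
  have hac : ∀ i j, AbsolutelyContinuousOnInterval (fun s => (ρ s - (ρ s)ᴴ) i j) t₀ tf :=
    fun i j => (h.2.1 i j).fun_sub ((h.2.1 j i).lipschitzWith_comp Complex.conjCLE.lipschitz)
  have hle := S.frobSq_le_of_ae_hasDerivAt hC0 hC hac (h.2.2.mono fun s hs => by
    refine ⟨u s, 1, zero_le_one, le_rfl, fun i j => ?_⟩
    rw [Complex.ofReal_one, one_smul, rhs_sub, ← conjTranspose_rhs]
    exact (hs i j).sub ((hs j i).star)) ht
  rw [h.1, hρ₀.eq, sub_self] at hle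
  have h0 : frobSq (0 : CMat N) = 0 := by simp [frobSq_eq_sum]
  rw [h0, zero_mul] at hle
  exact (sub_eq_zero.1 (eq_zero_of_frobSq_nonpos hle)).symm

variable (S) in
/-- An integrable majorant of the vector field for `|u| ≤ M` and entries of `ρ` of size `R`. -/
noncomputable def majorant (A M R t : ℝ) : ℝ :=
  A + M * (2 * R / S.hbar * ∑ k, ∑ l, ‖S.Hc t k l‖)

variable (S) in
theorem majorant_nonneg {A M R : ℝ} (hA : 0 ≤ A) (hM : 0 ≤ M) (hR : 0 ≤ R) (t : ℝ) :
    0 ≤ S.majorant A M R t := by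
  have := S.hbar_pos
  unfold majorant
  positivity

theorem integrableOn_majorant (hHc : ∀ i j, IntegrableOn (fun t => S.Hc t i j) (Icc t₀ tf))
    (A M R : ℝ) : IntegrableOn (S.majorant A M R) (Icc t₀ tf) := by
  refine Integrable.add (integrable_const A) (Integrable.const_mul (Integrable.const_mul ?_ _) _)
  exact integrable_finsetSum _ fun k _ => integrable_finsetSum _ fun l _ => (hHc k l).norm

theorem norm_rhs_entry_le {A M R v : ℝ}
    (hA : ∀ ρ : CMat N, (∀ i j, ‖ρ i j‖ ≤ R) → ∀ i j, ‖S.freeFlow ρ i j‖ ≤ A) (hv : |v| ≤ M)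
    {σ : CMat N} (hσ : ∀ i j, ‖σ i j‖ ≤ R) (t : ℝ) (i j : Fin N) :
    ‖S.rhs t v σ i j‖ ≤ S.majorant A M R t := by
  rw [rhs_eq_freeFlow_add, Matrix.add_apply, Matrix.smul_apply, smul_eq_mul]
  refine (norm_add_le _ _).trans (add_le_add (hA σ hσ i j) ?_)
  rw [norm_mul, Complex.norm_real, Real.norm_eq_abs]
  exact mul_le_mul hv (norm_hamFlow_entry_le S.hbar_pos _ _ hσ i j) (norm_nonneg _)
    ((abs_nonneg v).trans hv)

theorem aestronglyMeasurable_hamFlow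
    (hHc : ∀ i j, IntegrableOn (fun t => S.Hc t i j) (Icc t₀ tf))
    (hρ : ContinuousOn ρ (Icc t₀ tf)) :
    AEStronglyMeasurable (fun t => hamFlow S.hbar (S.Hc t) (ρ t)) (volume.restrict (Icc t₀ tf)) := by
  have h1 : AEStronglyMeasurable S.Hc (volume.restrict (Icc t₀ tf)) :=
    aestronglyMeasurable_matrix fun i j => (hHc i j).1
  have h2 : AEStronglyMeasurable ρ (volume.restrict (Icc t₀ tf)) := hρ.aestronglyMeasurable_matrix
  have h3 : AEStronglyMeasurable (fun t => (S.Hc t, ρ t)) (volume.restrict (Icc t₀ tf)) :=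
    h1.prodMk h2
  have h4 := Continuous.comp_aestronglyMeasurable (continuous_hamFlow S.hbar) h3
  exact h4.congr (ae_of_all _ fun t => rfl)

theorem aestronglyMeasurable_rhs
    (hHc : ∀ i j, IntegrableOn (fun t => S.Hc t i j) (Icc t₀ tf))
    (hu : AEStronglyMeasurable u (volume.restrict (Icc t₀ tf)))
    (hρ : ContinuousOn ρ (Icc t₀ tf)) :
    AEStronglyMeasurable (fun t => S.rhs t (u t) (ρ t)) (volume.restrict (Icc t₀ tf)) := by
  simp only [rhs_eq_freeFlow_add]
  refine AEStronglyMeasurable.add ?_ ?_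
  · exact S.continuous_freeFlow.comp_aestronglyMeasurable hρ.aestronglyMeasurable_matrix
  · exact (Complex.continuous_ofReal.comp_aestronglyMeasurable hu).smul
      (aestronglyMeasurable_hamFlow hHc hρ)

theorem integrableOn_rhs_entry {A M R : ℝ}
    (hA : ∀ ρ : CMat N, (∀ i j, ‖ρ i j‖ ≤ R) → ∀ i j, ‖S.freeFlow ρ i j‖ ≤ A)
    (hHc : ∀ i j, IntegrableOn (fun t => S.Hc t i j) (Icc t₀ tf))
    (hu : AEStronglyMeasurable u (volume.restrict (Icc t₀ tf)))
    (huM : ∀ᵐ t ∂volume.restrict (Icc t₀ tf), |u t| ≤ M)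
    (hρ : ContinuousOn ρ (Icc t₀ tf)) (hR : ∀ t ∈ Icc t₀ tf, ∀ i j, ‖ρ t i j‖ ≤ R) (i j : Fin N) :
    IntegrableOn (fun t => S.rhs t (u t) (ρ t) i j) (Icc t₀ tf) := by
  refine Integrable.mono' (integrableOn_majorant hHc A M R) ?_ ?_
  · exact (continuous_id.matrix_elem i j).comp_aestronglyMeasurable
      (aestronglyMeasurable_rhs hHc hu hρ)
  · filter_upwards [huM, ae_restrict_mem measurableSet_Icc] with t h1 h2
    exact norm_rhs_entry_le hA h1 (hR t h2) t i j

theorem IsTrajectory.sub_eq_integral (h : S.IsTrajectory t₀ tf ρ₀ u ρ)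
    {i j : Fin N} (hintg : IntegrableOn (fun t => S.rhs t (u t) (ρ t) i j) (Icc t₀ tf))
    {s t : ℝ} (hs : t₀ ≤ s) (hst : s ≤ t) (ht : t ≤ tf) :
    ρ t i j - ρ s i j = ∫ r in s..t, S.rhs r (u r) (ρ r) i j := by
  have hsub : Icc s t ⊆ Icc t₀ tf := Icc_subset_Icc hs ht
  refine (AbsolutelyContinuousOnInterval.integral_eq_sub_of_ae_hasDerivAt_complex hst
    ((h.2.1 i j).mono ?_) ((ae_restrict_of_ae_restrict_of_subset hsub h.2.2).mono fun r hr => hr i j)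
    ((intervalIntegrable_iff_integrableOn_Icc_of_le hst).2 (hintg.mono_set hsub))).symm
  rwa [uIcc_of_le hst, uIcc_of_le (hs.trans (hst.trans ht))]

/-- Lebesgue differentiation recovers the equation almost everywhere. The integral form is the one
that fixed-point and limit arguments deliver. -/
theorem isTrajectory_of_integral_eq (ht : t₀ ≤ tf)
    (hintg : ∀ i j, IntegrableOn (fun t => S.rhs t (u t) (ρ t) i j) (Icc t₀ tf))
    (h : ∀ t ∈ Icc t₀ tf, ∀ i j, ρ t i j = ρ₀ i j + ∫ s in t₀..t, S.rhs s (u s) (ρ s) i j) :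
    S.IsTrajectory t₀ tf ρ₀ u ρ := by
  have key := fun i j => absolutelyContinuousOnInterval_and_hasDerivAt_of_integral_eq ht (hintg i j)
    fun t hmem => h t hmem i j
  refine ⟨?_, fun i j => (key i j).1, ?_⟩
  · ext i j
    simpa using h t₀ (left_mem_Icc.2 ht) i j
  · exact ae_all_iff.2 fun i => ae_all_iff.2 fun j => (key i j).2

end OpenSystem

end Trajectories

/-! ### The regularised feedback law and its closed-loop trajectory. -/

section Feedback

open Filter Topology

variable {N K : ℕ}

/-- The scalar by which a matrix is retracted to the Frobenius ball of radius `R`. -/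
noncomputable def damping (R : ℝ) (ρ : CMat N) : ℝ := R / max R √(frobSq ρ)

theorem damping_nonneg {R : ℝ} (hR : 0 < R) (ρ : CMat N) : 0 ≤ damping R ρ :=
  div_nonneg hR.le (hR.le.trans (le_max_left _ _))

theorem damping_le_one {R : ℝ} (hR : 0 < R) (ρ : CMat N) : damping R ρ ≤ 1 :=
  (div_le_one (hR.trans_le (le_max_left _ _))).2 (le_max_left _ _)

theorem damping_eq_one {R : ℝ} (hR : 0 < R) {ρ : CMat N} (h : frobSq ρ ≤ R ^ 2) :
    damping R ρ = 1 := by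
  rw [damping, max_eq_left ((Real.sqrt_le_left hR.le).2 h), div_self hR.ne']

theorem continuous_damping {R : ℝ} (hR : 0 < R) : Continuous (damping R : CMat N → ℝ) :=
  continuous_const.div (continuous_const.max continuous_frobSq.sqrt)
    fun _ => (hR.trans_le (le_max_left _ _)).ne'

theorem norm_damping_smul_entry_le {R : ℝ} (hR : 0 < R) (ρ : CMat N) (i j : Fin N) :
    ‖((damping R ρ : ℂ) • ρ) i j‖ ≤ R := by
  have hm : 0 < max R √(frobSq ρ) := hR.trans_le (le_max_left _ _)
  rw [Matrix.smul_apply, smul_eq_mul, norm_mul, Complex.norm_real, Real.norm_eq_abs,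
    abs_of_nonneg (damping_nonneg hR ρ), damping, div_mul_eq_mul_div, div_le_iff₀ hm]
  exact mul_le_mul_of_nonneg_left
    ((norm_entry_le_sqrt_frobSq ρ i j).trans (le_max_right _ _)) hR.le

/-- Carathéodory's existence theorem for matrix-valued functions, entry by entry. -/
theorem exists_matrix_integral_eq {F : ℝ → CMat N → CMat N} {m : ℝ → ℝ} {a b : ℝ} (hab : a ≤ b)
    (hcont : ∀ t, Continuous (F t))
    (hmeas : ∀ x : ℝ → CMat N, Continuous x →
      AEStronglyMeasurable (fun s => F s (x s)) (volume.restrict (Icc a b)))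
    (hm : IntegrableOn m (Icc a b)) (hm0 : ∀ t, 0 ≤ m t) (hFm : ∀ t x i j, ‖F t x i j‖ ≤ m t)
    (x₀ : CMat N) :
    ∃ y : ℝ → CMat N, Continuous y ∧ (∀ i j, IntegrableOn (fun s => F s (y s) i j) (Icc a b)) ∧
      ∀ t ∈ Icc a b, ∀ i j, y t i j = x₀ i j + ∫ s in a..t, F s (y s) i j := by
  let f : ℝ → (Fin N → Fin N → ℂ) → (Fin N → Fin N → ℂ) := F
  have hfm : ∀ t x, ‖f t x‖ ≤ m t := fun t x =>
    (pi_norm_le_iff_of_nonneg (hm0 t)).2 fun i => (pi_norm_le_iff_of_nonneg (hm0 t)).2 fun j =>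
      hFm t x i j
  have hfmeas : ∀ x : ℝ → Fin N → Fin N → ℂ, Continuous x →
      AEStronglyMeasurable (fun s => f s (x s)) (volume.restrict (Icc a b)) := hmeas
  obtain ⟨y, hyc, hy⟩ := exists_integral_eq_of_integrable_majorant hab (fun t _ => hcont t) hfmeas
    hm (fun t _ x => hfm t x) x₀
  have hfint : IntegrableOn (fun s => f s (y s)) (Icc a b) :=
    Integrable.mono' hm (hfmeas y hyc) (ae_of_all _ fun t => hfm t _)
  refine ⟨y, hyc, fun i j => (hfint.eval i).eval j, fun t hmem i j => ?_⟩
  have hintg : IntervalIntegrable (fun s => f s (y s)) volume a t :=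
    (intervalIntegrable_iff_integrableOn_Icc_of_le hmem.1).2
      (hfint.mono_set (Icc_subset_Icc_right hmem.2))
  let ℓ₁ : (Fin N → Fin N → ℂ) →L[ℝ] (Fin N → ℂ) := ContinuousLinearMap.proj i
  let ℓ₂ : (Fin N → ℂ) →L[ℝ] ℂ := ContinuousLinearMap.proj j
  have h1 : ∫ s in a..t, f s (y s) i j = (∫ s in a..t, f s (y s)) i j :=
    (ℓ₂.comp ℓ₁).intervalIntegral_comp_comm hintg
  refine (congrFun (congrFun (hy t hmem) i) j).trans ?_
  exact congrArg (x₀ i j + ·) h1.symm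

namespace OpenSystem

variable (S : OpenSystem N K)

/-- The rate of change of `C²` in the absence of control. -/
noncomputable def coherenceDrift (ρ : CMat N) : ℝ := coherenceDeriv ρ (S.freeFlow ρ)

/-- The rate of change of `C²` per unit of control. -/
noncomputable def coherenceGain (H ρ : CMat N) : ℝ := coherenceDeriv ρ (hamFlow S.hbar H ρ)

/-- The feedback law which cancels the drift of `C²` where the gain is at least `e`. -/
noncomputable def feedback (e : ℝ) (H ρ : CMat N) : ℝ :=
  -S.coherenceDrift ρ * S.coherenceGain H ρ / max (S.coherenceGain H ρ ^ 2) (e ^ 2)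

theorem coherenceDeriv_rhs (t v : ℝ) (ρ : CMat N) :
    coherenceDeriv ρ (S.rhs t v ρ) = S.coherenceDrift ρ + v * S.coherenceGain (S.Hc t) ρ := by
  rw [rhs_eq_freeFlow_add, coherenceDeriv_add_right, coherenceDeriv_smul_right]; rfl

theorem continuous_coherenceDrift : Continuous S.coherenceDrift :=
  continuous_id.coherenceDeriv S.continuous_freeFlow

theorem continuous_coherenceGain :
    Continuous fun p : CMat N × CMat N => S.coherenceGain p.1 p.2 :=
  continuous_snd.coherenceDeriv (continuous_hamFlow S.hbar)

theorem continuous_feedback {e : ℝ} (he : 0 < e) :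
    Continuous fun p : CMat N × CMat N => S.feedback e p.1 p.2 := by
  have h1 := S.continuous_coherenceGain
  have h2 := S.continuous_coherenceDrift.comp (continuous_snd (X := CMat N) (Y := CMat N))
  exact (h2.neg.mul h1).div ((h1.pow 2).max continuous_const)
    fun _ => ((pow_pos he 2).trans_le (le_max_right _ _)).ne'

theorem feedback_mul_coherenceGain {e : ℝ} (he : 0 < e) {H ρ : CMat N}
    (h : e ≤ |S.coherenceGain H ρ|) :
    S.feedback e H ρ * S.coherenceGain H ρ = -S.coherenceDrift ρ := by
  have h0 : S.coherenceGain H ρ ≠ 0 := abs_pos.1 (he.trans_le h)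
  have h1 : e ^ 2 ≤ S.coherenceGain H ρ ^ 2 := sq_le_sq.2 (by rwa [abs_of_pos he])
  rw [feedback, max_eq_left h1]
  field_simp

/-- This rests on `|g| e ≤ max (g²) (e²)`, so the bound persists where the gain degenerates. -/
theorem abs_feedback_le {e : ℝ} (he : 0 < e) (H ρ : CMat N) :
    |S.feedback e H ρ| ≤ |S.coherenceDrift ρ| / e := by
  set g := S.coherenceGain H ρ with hg
  have hm : 0 < max (g ^ 2) (e ^ 2) := (pow_pos he 2).trans_le (le_max_right _ _)
  have key : |g| * e ≤ max (g ^ 2) (e ^ 2) := by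
    rcases le_total |g| e with h | h
    · refine le_max_of_le_right ?_
      nlinarith [abs_nonneg g]
    · refine le_max_of_le_left ?_
      rw [← sq_abs g]
      nlinarith [abs_nonneg g]
  rw [feedback, ← hg, abs_div, abs_mul, abs_neg, abs_of_pos hm, div_le_div_iff₀ hm he, mul_assoc]
  exact mul_le_mul_of_nonneg_left key (abs_nonneg _)

theorem exists_abs_coherenceDrift_le (R : ℝ) :
    ∃ D : ℝ, 0 ≤ D ∧ ∀ ρ : CMat N, (∀ i j, ‖ρ i j‖ ≤ R) → |S.coherenceDrift ρ| ≤ D := by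
  let F : (Fin N → Fin N → ℂ) → ℝ := S.coherenceDrift
  have hc : Continuous F := S.continuous_coherenceDrift
  obtain ⟨D, hD⟩ := (isCompact_closedBall (0 : Fin N → Fin N → ℂ) |R|).exists_bound_of_continuousOn
    hc.continuousOn
  refine ⟨max D 0, le_max_right _ _, fun ρ hρ => le_max_of_le_left (hD ρ ?_)⟩
  let x : Fin N → Fin N → ℂ := ρ
  change x ∈ _
  rw [mem_closedBall_zero_iff]
  exact (pi_norm_le_iff_of_nonneg (abs_nonneg R)).2 fun i =>
    (pi_norm_le_iff_of_nonneg (abs_nonneg R)).2 fun j => (hρ i j).trans (le_abs_self R)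

variable {S} {t₀ tf : ℝ} {ρ₀ : CMat N}

/-- The closed-loop system with the feedback law has a trajectory. -/
theorem exists_isTrajectory_feedback (ht : t₀ ≤ tf)
    (hHc : ∀ i j, IntegrableOn (fun t => S.Hc t i j) (Icc t₀ tf)) {C R e D : ℝ} (hC0 : 0 ≤ C)
    (hC : ∀ ρ : CMat N, frobInner ρ (S.dissipator ρ) ≤ C * frobSq ρ) (hR : 0 < R) (hD0 : 0 ≤ D)
    (hρ₀ : frobSq ρ₀ * Real.exp (2 * C * (tf - t₀)) ≤ R ^ 2) (he : 0 < e)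
    (hD : ∀ ρ : CMat N, (∀ i j, ‖ρ i j‖ ≤ R) → |S.coherenceDrift ρ| ≤ D) :
    ∃ (u : ℝ → ℝ) (ρ : ℝ → CMat N), S.IsTrajectory t₀ tf ρ₀ u ρ ∧
      AEStronglyMeasurable u (volume.restrict (Icc t₀ tf)) ∧
      ∀ t ∈ Icc t₀ tf, u t = S.feedback e (S.Hc t) (ρ t) ∧ |u t| ≤ D / e := by
  obtain ⟨A, hA0, hA⟩ := S.exists_norm_freeFlow_entry_le R
  -- Composing with the retraction gives the closed-loop field an integrable majorant valid for all
  -- states.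
  let P : CMat N → CMat N := fun x => (damping R x : ℂ) • x
  have hP : Continuous P :=
    (Complex.continuous_ofReal.comp (continuous_damping hR)).smul continuous_id
  have hPR : ∀ x i j, ‖P x i j‖ ≤ R := norm_damping_smul_entry_le hR
  have hfb : ∀ H x, |S.feedback e H (P x)| ≤ D / e := fun H x =>
    (S.abs_feedback_le he H (P x)).trans (div_le_div_of_nonneg_right (hD _ (hPR x)) he.le)
  let f : ℝ → CMat N → CMat N := fun t x => S.rhs t (S.feedback e (S.Hc t) (P x)) (P x)
  have hHcm : AEStronglyMeasurable S.Hc (volume.restrict (Icc t₀ tf)) :=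
    aestronglyMeasurable_matrix fun i j => (hHc i j).1
  have humeas : ∀ y : ℝ → CMat N, ContinuousOn y (Icc t₀ tf) →
      AEStronglyMeasurable (fun t => S.feedback e (S.Hc t) (y t))
        (volume.restrict (Icc t₀ tf)) := by
    intro y hy
    have h1 : AEStronglyMeasurable (fun t => (S.Hc t, y t)) (volume.restrict (Icc t₀ tf)) :=
      hHcm.prodMk hy.aestronglyMeasurable_matrix
    have h2 := Continuous.comp_aestronglyMeasurable (S.continuous_feedback he) h1
    exact h2.congr (ae_of_all _ fun t => rfl)
  have hfcont : ∀ t, Continuous (f t) := by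
    intro t
    have h1 : Continuous fun x : CMat N => S.feedback e (S.Hc t) (P x) :=
      have := (S.continuous_feedback he).comp ((continuous_const (y := S.Hc t)).prodMk hP)
      this
    simp only [f, rhs_eq_freeFlow_add]
    exact (S.continuous_freeFlow.comp hP).add ((Complex.continuous_ofReal.comp h1).smul
      (continuous_const.hamFlow hP S.hbar))
  have hfmeas : ∀ x : ℝ → CMat N, Continuous x →
      AEStronglyMeasurable (fun s => f s (x s)) (volume.restrict (Icc t₀ tf)) := by
    intro x hx
    have hPx : ContinuousOn (fun t => P (x t)) (Icc t₀ tf) :=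
      Continuous.continuousOn (hP.comp hx)
    have := aestronglyMeasurable_rhs hHc (humeas _ hPx) hPx
    exact this.congr (ae_of_all _ fun t => rfl)
  obtain ⟨ρ, hρc, hent, hρ⟩ := exists_matrix_integral_eq ht hfcont hfmeas
    (integrableOn_majorant hHc A (D / e) R)
    (S.majorant_nonneg hA0 (div_nonneg hD0 he.le) hR.le)
    (fun t x => norm_rhs_entry_le hA (hfb _ x) (hPR x) t) ρ₀
  have hder := fun i j => absolutelyContinuousOnInterval_and_hasDerivAt_of_integral_eq ht
    (hent i j) fun t hmem => hρ t hmem i j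
  have hρt₀ : ρ t₀ = ρ₀ := by
    ext i j
    simpa using hρ t₀ (left_mem_Icc.2 ht) i j
  -- The retracted field is a damped Lindblad field, so the energy estimate keeps the solution in
  -- the ball, where the retraction is the identity.
  have hbound : ∀ t ∈ Icc t₀ tf, frobSq (ρ t) ≤ R ^ 2 := by
    intro t hmem
    refine le_trans ?_ hρ₀
    rw [← hρt₀]
    refine S.frobSq_le_of_ae_hasDerivAt hC0 hC (fun i j => (hder i j).1) ?_ hmem
    filter_upwards [ae_all_iff.2 fun i => ae_all_iff.2 fun j => (hder i j).2] with s hs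
    refine ⟨S.feedback e (S.Hc s) (P (ρ s)), damping R (ρ s), damping_nonneg hR _,
      damping_le_one hR _, fun i j => ?_⟩
    rw [← rhs_smul]
    exact hs i j
  have hPρ : ∀ t ∈ Icc t₀ tf, P (ρ t) = ρ t := by
    intro t hmem
    simp only [P]
    rw [damping_eq_one hR (hbound t hmem), Complex.ofReal_one, one_smul]
  have hfρ : ∀ t ∈ Icc t₀ tf, f t (ρ t) = S.rhs t (S.feedback e (S.Hc t) (ρ t)) (ρ t) := by
    intro t hmem
    change S.rhs t (S.feedback e (S.Hc t) (P (ρ t))) (P (ρ t)) = _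
    rw [hPρ t hmem]
  refine ⟨fun t => S.feedback e (S.Hc t) (ρ t), ρ, isTrajectory_of_integral_eq ht
    (fun i j => (hent i j).congr_fun (fun t hmem => by simp only [hfρ t hmem]) measurableSet_Icc) ?_,
    humeas ρ hρc.continuousOn, fun t hmem => ⟨rfl, ?_⟩⟩
  · intro t hmem i j
    rw [hρ t hmem i j, intervalIntegral.integral_congr
      (g := fun s => S.rhs s (S.feedback e (S.Hc s) (ρ s)) (ρ s) i j)]
    intro s hs
    rw [uIcc_of_le hmem.1] at hs
    simp only [hfρ s ⟨hs.1, hs.2.trans hmem.2⟩]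
  · have := hfb (S.Hc t) (ρ t)
    rwa [hPρ t hmem] at this

/-- A trajectory of the closed-loop system keeps `C²` constant as long as `Φ` does not
degenerate. -/
theorem coherence_sq_eq_of_feedback (ht : t₀ ≤ tf)
    (hHc_right : ∀ t ∈ Ico t₀ tf, ContinuousWithinAt S.Hc (Ici t) t)
    (hρ₀ : ρ₀.IsHermitian) {α β : ℝ} (hC : coherence ρ₀ ^ 2 ∈ Icc α β) {Ω : Set ℝ} {ε e : ℝ}
    (he : 0 < e) (heε : S.hbar * e < ε) (hΦ : S.PhiBoundedAway t₀ tf ρ₀ α β Ω ε) {u : ℝ → ℝ}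
    (hu : u ∈ controls t₀ tf Ω) {ρ : ℝ → CMat N} (hρ : S.IsTrajectory t₀ tf ρ₀ u ρ)
    (hfb : ∀ t ∈ Icc t₀ tf, u t = S.feedback e (S.Hc t) (ρ t)) {t : ℝ} (hmem : t ∈ Icc t₀ tf) :
    coherence (ρ t) ^ 2 = coherence ρ₀ ^ 2 := by
  have hcont := hρ.continuousOn ht
  have hac := absolutelyContinuousOnInterval_coherence_sq hρ.2.1
  let s : Set ℝ := {t | coherence (ρ t) ^ 2 = coherence ρ₀ ^ 2}
  have hclosed : IsClosed (s ∩ Icc t₀ tf) := by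
    have h1 : ContinuousOn (fun t => coherence (ρ t) ^ 2) (Icc t₀ tf) :=
      continuous_coherence_sq.comp_continuousOn hcont
    have := h1.preimage_isClosed_of_isClosed isClosed_Icc
      (isClosed_singleton (x := coherence ρ₀ ^ 2))
    rwa [inter_comm] at this
  -- Continuous induction: `s` is closed in the interval and contains `t₀`. It remains to extend it
  -- to the right of any `t` up to which it is full.
  have hstart : t₀ ∈ s := by simp only [s, mem_ofPred_eq, hρ.1]
  refine hclosed.Icc_subset_of_forall_mem_nhdsGT_of_Icc_subset hstart ?_ hmem
  intro t htm hsub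
  have htm' : t ∈ Icc t₀ tf := Ico_subset_Icc_self htm
  have hlow := hΦ u hu ρ hρ t htm' fun r hr => by
    have : coherence (ρ r) ^ 2 = coherence ρ₀ ^ 2 := hsub hr
    rwa [this]
  rw [Phi_eq_coherenceDeriv S.hbar_pos (S.Hc_herm t) (hρ.isHermitian hρ₀ htm'),
    Complex.norm_real, Real.norm_eq_abs, abs_mul, abs_of_pos S.hbar_pos] at hlow
  -- The hypothesis on `Φ` says nothing beyond `t`; the strict gap between `e` and `ε / ℏ` is what
  -- survives on a short interval to the right.
  have hgain : e < |S.coherenceGain (S.Hc t) (ρ t)| :=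
    lt_of_mul_lt_mul_left (heε.trans_le hlow) S.hbar_pos.le
  have hρr : ContinuousWithinAt ρ (Ici t) t :=
    (hcont t htm').mono_of_mem_nhdsWithin (Icc_mem_nhdsGE_of_mem htm)
  have hgr : ContinuousWithinAt (fun r => |S.coherenceGain (S.Hc r) (ρ r)|) (Ici t) t := by
    have := S.continuous_coherenceGain.abs.continuousAt.comp_continuousWithinAt
      (f := fun r => (S.Hc r, ρ r)) ((hHc_right t htm).prodMk hρr)
    exact this
  have hev : ∀ᶠ r in 𝓝[≥] t, e < |S.coherenceGain (S.Hc r) (ρ r)| ∧ r ∈ Icc t₀ tf :=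
    (hgr.eventually (lt_mem_nhds hgain)).and (Icc_mem_nhdsGE_of_mem htm)
  obtain ⟨d, hd, hdsub⟩ := mem_nhdsGE_iff_exists_Ico_subset.1 hev
  refine mem_of_superset (Ioo_mem_nhdsGT hd) fun r hr => ?_
  have hrmem : r ∈ Icc t₀ tf := (hdsub ⟨hr.1.le, hr.2⟩).2
  have hsub' : Icc t r ⊆ Icc t₀ tf := Icc_subset_Icc htm.1 hrmem.2
  have hconst := (hac.mono (c := t) (d := r) (by
      rwa [uIcc_of_le hr.1.le, uIcc_of_le ht])).integral_eq_sub_of_ae_hasDerivAt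
    hr.1.le (f' := fun _ => 0) (by
      filter_upwards [ae_restrict_of_ae_restrict_of_subset hsub' hρ.2.2,
        ae_restrict_mem measurableSet_Icc] with x hx hxmem
      refine (hasDerivAt_coherence_sq hx).congr_deriv ?_
      have hxg : e ≤ |S.coherenceGain (S.Hc x) (ρ x)| :=
        (hdsub ⟨hxmem.1, hxmem.2.trans_lt hr.2⟩).1.le
      rw [coherenceDeriv_rhs, hfb x (hsub' hxmem), S.feedback_mul_coherenceGain he hxg,
        add_neg_cancel])
  rw [intervalIntegral.integral_zero] at hconst
  have hts : coherence (ρ t) ^ 2 = coherence ρ₀ ^ 2 := hsub (right_mem_Icc.2 htm.1)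
  change coherence (ρ r) ^ 2 = coherence ρ₀ ^ 2
  linarith

end OpenSystem

end Feedback

/-! ### Compactness of the feasible controls and existence of a minimiser. -/

section Optimality

open Filter Topology

variable {N K : ℕ}

/-- Weak-* convergence of bounded real functions against real test functions extends to complex
test functions. -/
theorem tendsto_integral_ofReal_mul {μ : Measure ℝ} {u : ℕ → ℝ → ℝ} {v : ℝ → ℝ} {M : ℝ}
    (hu : ∀ n, AEStronglyMeasurable (u n) μ) (huM : ∀ n, ∀ᵐ t ∂μ, ‖u n t‖ ≤ M)
    (hv : AEStronglyMeasurable v μ) (hvM : ∀ᵐ t ∂μ, ‖v t‖ ≤ M)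
    (hlim : ∀ g : ℝ → ℝ, Integrable g μ →
      Tendsto (fun n => ∫ t, u n t * g t ∂μ) atTop (𝓝 (∫ t, v t * g t ∂μ)))
    {h : ℝ → ℂ} (hh : Integrable h μ) :
    Tendsto (fun n => ∫ t, (u n t : ℂ) * h t ∂μ) atTop (𝓝 (∫ t, (v t : ℂ) * h t ∂μ)) := by
  have key : ∀ w : ℝ → ℝ, AEStronglyMeasurable w μ → (∀ᵐ t ∂μ, ‖w t‖ ≤ M) →
      ∫ t, (w t : ℂ) * h t ∂μ =
        ((∫ t, w t * (h t).re ∂μ : ℝ) : ℂ) + ((∫ t, w t * (h t).im ∂μ : ℝ) : ℂ) * Complex.I := by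
    intro w hw hwM
    have hintg : Integrable (fun t => (w t : ℂ) * h t) μ :=
      hh.bdd_mul (Complex.continuous_ofReal.comp_aestronglyMeasurable hw)
        (hwM.mono fun t ht => by rwa [Complex.norm_real])
    have h1 := Complex.reCLM.integral_comp_comm hintg
    have h2 := Complex.imCLM.integral_comp_comm hintg
    simp only [Complex.reCLM_apply, Complex.imCLM_apply, Complex.re_ofReal_mul,
      Complex.im_ofReal_mul] at h1 h2
    rw [h1, h2, Complex.re_add_im]
  rw [key v hv hvM]
  refine Tendsto.congr (fun n => (key (u n) (hu n) (huM n)).symm) ?_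
  exact ((Complex.continuous_ofReal.tendsto _).comp (hlim _ hh.re)).add
    (((Complex.continuous_ofReal.tendsto _).comp (hlim _ hh.im)).mul_const _)

namespace OpenSystem

variable {S : OpenSystem N K} {t₀ tf : ℝ} {ρ₀ : CMat N}

/-- Passage to the limit in the integrated Lindblad equation. -/
theorem tendsto_integral_rhs (hHc : ∀ i j, IntegrableOn (fun t => S.Hc t i j) (Icc t₀ tf))
    {A M R : ℝ} (hA0 : 0 ≤ A)
    (hA : ∀ ρ : CMat N, (∀ i j, ‖ρ i j‖ ≤ R) → ∀ i j, ‖S.freeFlow ρ i j‖ ≤ A)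
    {u : ℕ → ℝ → ℝ} {v : ℝ → ℝ}
    (hu : ∀ n, AEStronglyMeasurable (u n) (volume.restrict (Icc t₀ tf)))
    (huM : ∀ n, ∀ᵐ t ∂volume.restrict (Icc t₀ tf), |u n t| ≤ M)
    (hv : AEStronglyMeasurable v (volume.restrict (Icc t₀ tf)))
    (hvM : ∀ᵐ t ∂volume.restrict (Icc t₀ tf), |v t| ≤ M)
    (hlim : ∀ g : ℝ → ℝ, Integrable g (volume.restrict (Icc t₀ tf)) →
      Tendsto (fun n => ∫ t in Icc t₀ tf, u n t * g t) atTop (𝓝 (∫ t in Icc t₀ tf, v t * g t)))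
    {ρ : ℕ → ℝ → CMat N} {σ : ℝ → CMat N} (hρ : ∀ n, ContinuousOn (ρ n) (Icc t₀ tf))
    (hρR : ∀ n, ∀ t ∈ Icc t₀ tf, ∀ i j, ‖ρ n t i j‖ ≤ R) (hσ : ContinuousOn σ (Icc t₀ tf))
    (hσR : ∀ t ∈ Icc t₀ tf, ∀ i j, ‖σ t i j‖ ≤ R)
    (hρσ : ∀ t ∈ Icc t₀ tf, Tendsto (fun n => ρ n t) atTop (𝓝 (σ t)))
    {t : ℝ} (ht : t ∈ Icc t₀ tf) (i j : Fin N) :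
    Tendsto (fun n => ∫ s in t₀..t, S.rhs s (u n s) (ρ n s) i j) atTop
      (𝓝 (∫ s in t₀..t, S.rhs s (v s) (σ s) i j)) := by
  have hsub : Ioc t₀ t ⊆ Icc t₀ tf := fun s hs => ⟨hs.1.le, hs.2.trans ht.2⟩
  let h : ℝ → ℂ := fun s => hamFlow S.hbar (S.Hc s) (σ s) i j
  let m : ℝ → ℝ := S.majorant A M R
  have hm : IntegrableOn m (Icc t₀ tf) := integrableOn_majorant hHc A M R
  have hbound : ∀ s ∈ Icc t₀ tf, ∀ w : ℝ, |w| ≤ M → ‖(w : ℂ) * h s‖ ≤ m s := by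
    intro s hs w hw
    have h1 := mul_le_mul hw (norm_hamFlow_entry_le S.hbar_pos (S.Hc s) (σ s) (hσR s hs) i j)
      (norm_nonneg _) ((abs_nonneg w).trans hw)
    rw [norm_mul, Complex.norm_real, Real.norm_eq_abs]
    refine h1.trans ?_
    simp only [m, majorant]
    linarith
  have hhmeas : AEStronglyMeasurable h (volume.restrict (Icc t₀ tf)) :=
    (continuous_id.matrix_elem i j).comp_aestronglyMeasurable (aestronglyMeasurable_hamFlow hHc hσ)
  have hh : IntegrableOn h (Icc t₀ tf) := by
    refine Integrable.mono' (integrableOn_majorant hHc 0 1 R) hhmeas ?_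
    filter_upwards [ae_restrict_mem measurableSet_Icc] with s hs
    have := norm_hamFlow_entry_le S.hbar_pos (S.Hc s) (σ s) (hσR s hs) i j
    simpa only [majorant, zero_add, one_mul] using this
  have huh : ∀ w : ℝ → ℝ, AEStronglyMeasurable w (volume.restrict (Icc t₀ tf)) →
      (∀ᵐ t ∂volume.restrict (Icc t₀ tf), |w t| ≤ M) →
      IntegrableOn (fun s => (w s : ℂ) * h s) (Icc t₀ tf) := fun w hw hwM =>
    Integrable.bdd_mul hh (Complex.continuous_ofReal.comp_aestronglyMeasurable hw)
      (hwM.mono fun t ht => by rwa [Complex.norm_real])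
  -- Here the state is frozen at its limit `σ`, so `h`, cut off to `(t₀, t]`, is a fixed integrable
  -- test function.
  have hweak : Tendsto (fun n => ∫ s in t₀..t, (u n s : ℂ) * h s) atTop
      (𝓝 (∫ s in t₀..t, (v s : ℂ) * h s)) := by
    have h1 := tendsto_integral_ofReal_mul hu huM hv hvM hlim
      (Integrable.indicator hh (measurableSet_Ioc (a := t₀) (b := t)))
    have h2 : ∀ w : ℝ → ℝ, ∫ s in Icc t₀ tf, (w s : ℂ) * (Ioc t₀ t).indicator h s
        = ∫ s in t₀..t, (w s : ℂ) * h s := by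
      intro w
      have h3 : (fun s => (w s : ℂ) * (Ioc t₀ t).indicator h s)
          = (Ioc t₀ t).indicator fun s => (w s : ℂ) * h s := by
        funext s
        by_cases hs : s ∈ Ioc t₀ t <;> simp [hs]
      rw [h3, integral_indicator measurableSet_Ioc, Measure.restrict_restrict measurableSet_Ioc,
        inter_eq_left.2 hsub, intervalIntegral.integral_of_le ht.1]
    simpa only [h2] using h1
  -- The remainder is the free flow plus `u n` times a difference tending to zero pointwise. Bounded
  -- controls suffice here, by dominated convergence.
  have hstrong : Tendsto
      (fun n => ∫ s in t₀..t, (S.rhs s (u n s) (ρ n s) i j - (u n s : ℂ) * h s)) atTop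
      (𝓝 (∫ s in t₀..t, S.freeFlow (σ s) i j)) := by
    have hmI : IntervalIntegrable m volume t₀ t :=
      (intervalIntegrable_iff_integrableOn_Ioc_of_le ht.1).2 (hm.mono_set hsub)
    have hall : ∀ᵐ s ∂volume, s ∈ Ioc t₀ t → ∀ n, |u n s| ≤ M := by
      rw [← ae_restrict_iff' measurableSet_Ioc]
      exact ae_restrict_of_ae_restrict_of_subset hsub (ae_all_iff.2 huM)
    refine intervalIntegral.tendsto_integral_filter_of_dominated_convergence (fun s => m s + m s)
      (Eventually.of_forall fun n => ?_) (Eventually.of_forall fun n => ?_) (hmI.add hmI) ?_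
    · rw [uIoc_of_le ht.1]
      exact (((integrableOn_rhs_entry hA hHc (hu n) (huM n) (hρ n) (hρR n) i j).sub
        (huh _ (hu n) (huM n))).mono_set hsub).1
    · filter_upwards [hall] with s hs hmem
      rw [uIoc_of_le ht.1] at hmem
      have hw := hs hmem n
      exact (norm_sub_le _ _).trans (add_le_add
        (norm_rhs_entry_le hA hw (hρR n s (hsub hmem)) s i j) (hbound s (hsub hmem) _ hw))
    · filter_upwards [hall] with s hs hmem
      rw [uIoc_of_le ht.1] at hmem
      have hconv := hρσ s (hsub hmem)
      have h1 : Tendsto (fun n => S.freeFlow (ρ n s) i j) atTop (𝓝 (S.freeFlow (σ s) i j)) :=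
        (((continuous_id.matrix_elem i j).comp S.continuous_freeFlow).tendsto (σ s)).comp hconv
      have h2 : Tendsto (fun n => hamFlow S.hbar (S.Hc s) (ρ n s) i j - h s) atTop (𝓝 0) := by
        have h3 : Continuous fun x : CMat N => hamFlow S.hbar (S.Hc s) x i j :=
          (continuous_id.matrix_elem i j).comp (continuous_const.hamFlow continuous_id S.hbar)
        have h4 := ((h3.tendsto (σ s)).comp hconv).sub_const (h s)
        rw [sub_self] at h4
        exact h4
      have h5 : Tendsto (fun n => (u n s : ℂ) * (hamFlow S.hbar (S.Hc s) (ρ n s) i j - h s)) atTop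
          (𝓝 0) := by
        refine squeeze_zero_norm (a := fun n => M * ‖hamFlow S.hbar (S.Hc s) (ρ n s) i j - h s‖)
          (fun n => ?_) (by simpa using h2.norm.const_mul M)
        rw [norm_mul, Complex.norm_real]
        exact mul_le_mul_of_nonneg_right (hs hmem n) (norm_nonneg _)
      have h6 := h1.add h5
      rw [add_zero] at h6
      refine h6.congr fun n => ?_
      rw [rhs_eq_freeFlow_add, Matrix.add_apply, Matrix.smul_apply, smul_eq_mul]
      ring
  have hII : ∀ {f : ℝ → ℂ}, IntegrableOn f (Icc t₀ tf) → IntervalIntegrable f volume t₀ t :=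
    fun hf => (intervalIntegrable_iff_integrableOn_Ioc_of_le ht.1).2 (hf.mono_set hsub)
  have hfree : IntegrableOn (fun s => S.freeFlow (σ s) i j) (Icc t₀ tf) := by
    have hc : ContinuousOn (fun s => S.freeFlow (σ s) i j) (Icc t₀ tf) :=
      ((continuous_id.matrix_elem i j).comp S.continuous_freeFlow).comp_continuousOn hσ
    exact hc.integrableOn_Icc
  have hsum := hstrong.add hweak
  have hlimit : ∫ s in t₀..t, S.rhs s (v s) (σ s) i j
      = (∫ s in t₀..t, S.freeFlow (σ s) i j) + ∫ s in t₀..t, (v s : ℂ) * h s := by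
    rw [← intervalIntegral.integral_add (hII hfree) (hII (huh v hv hvM))]
    simp only [rhs_eq_freeFlow_add, Matrix.add_apply, Matrix.smul_apply, smul_eq_mul, h]
  rw [hlimit]
  refine hsum.congr fun n => ?_
  rw [← intervalIntegral.integral_add
    ((hII (integrableOn_rhs_entry hA hHc (hu n) (huM n) (hρ n) (hρR n) i j)).sub
      (hII (huh _ (hu n) (huM n)))) (hII (huh _ (hu n) (huM n)))]
  simp only [sub_add_cancel]

/-- Sequential weak-* compactness of the set of feasible controls. -/
theorem exists_subseq_feasibleControls (ht : t₀ ≤ tf)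
    (hHc : ∀ i j, IntegrableOn (fun t => S.Hc t i j) (Icc t₀ tf)) {α β a b : ℝ} {u : ℕ → ℝ → ℝ}
    (hu : ∀ n, u n ∈ S.feasibleControls t₀ tf ρ₀ α β (Icc a b)) :
    ∃ φ : ℕ → ℕ, StrictMono φ ∧ ∃ v ∈ S.feasibleControls t₀ tf ρ₀ α β (Icc a b),
      ∀ g : ℝ → ℝ, Integrable g (volume.restrict (Icc t₀ tf)) →
        Tendsto (fun n => ∫ t in Icc t₀ tf, u (φ n) t * g t) atTop
          (𝓝 (∫ t in Icc t₀ tf, v t * g t)) := by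
  obtain ⟨C, hC0, hC⟩ := S.exists_frobInner_dissipator_le
  set R : ℝ := √(frobSq ρ₀ * Real.exp (2 * C * (tf - t₀))) with hRdef
  obtain ⟨A, hA0, hA⟩ := S.exists_norm_freeFlow_entry_le R
  set M : ℝ := max |a| |b| with hMdef
  have hM0 : 0 ≤ M := le_max_of_le_left (abs_nonneg a)
  have hIM : ∀ {x : ℝ}, x ∈ Icc a b → |x| ≤ M := fun hx => abs_le_max_abs_abs hx.1 hx.2
  choose hctrl ρ hρ hcoh using hu
  have humeas : ∀ n, AEStronglyMeasurable (u n) (volume.restrict (Icc t₀ tf)) := fun n =>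
    (hctrl n).1.1
  have hucc : ∀ n, ∀ᵐ t ∂volume.restrict (Icc t₀ tf), u n t ∈ Icc a b := fun n => (hctrl n).2
  have huM : ∀ n, ∀ᵐ t ∂volume.restrict (Icc t₀ tf), |u n t| ≤ M := fun n =>
    (hucc n).mono fun t h => hIM h
  have hρR : ∀ n, ∀ t ∈ Icc t₀ tf, ∀ i j, ‖ρ n t i j‖ ≤ R := fun n t hmem i j =>
    Real.le_sqrt_of_sq_le
      ((norm_entry_sq_le_frobSq _ i j).trans ((hρ n).frobSq_le hC0 hC hmem))
  have hρc : ∀ n, ContinuousOn (ρ n) (Icc t₀ tf) := fun n => (hρ n).continuousOn ht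
  have hintg : ∀ n i j, IntegrableOn (fun t => S.rhs t (u n t) (ρ n t) i j) (Icc t₀ tf) :=
    fun n i j => integrableOn_rhs_entry hA hHc (humeas n) (huM n) (hρc n) (hρR n) i j
  let m : ℝ → ℝ := S.majorant A M R
  have hm : IntegrableOn m (Icc t₀ tf) := integrableOn_majorant hHc A M R
  have hm0 : ∀ t, 0 ≤ m t := S.majorant_nonneg hA0 hM0 (Real.sqrt_nonneg _)
  let G : ℝ → ℝ := fun t => ∫ s in t₀..t, m s
  have hG : ContinuousOn G (Icc t₀ tf) := by
    have := intervalIntegral.continuousOn_primitive_interval (μ := volume) (f := m) (a := t₀)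
      (b := tf) (by rwa [uIcc_of_le ht])
    rwa [uIcc_of_le ht] at this
  have hmI : ∀ t ∈ Icc t₀ tf, IntervalIntegrable m volume t₀ t := fun t hmem =>
    (intervalIntegrable_iff_integrableOn_Icc_of_le hmem.1).2
      (hm.mono_set (Icc_subset_Icc_right hmem.2))
  have hent : ∀ n, ∀ s ∈ Icc t₀ tf, ∀ t ∈ Icc t₀ tf, s ≤ t → ∀ i j,
      ‖ρ n t i j - ρ n s i j‖ ≤ |G t - G s| := by
    intro n s hs t hmem hst i j
    have hsub : Ioc s t ⊆ Icc t₀ tf := fun r hr => ⟨hs.1.trans hr.1.le, hr.2.trans hmem.2⟩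
    rw [(hρ n).sub_eq_integral (hintg n i j) hs.1 hst hmem.2]
    simp only [G]
    rw [intervalIntegral.integral_interval_sub_left (hmI t hmem) (hmI s hs)]
    refine intervalIntegral.norm_integral_le_abs_of_norm_le ?_ ?_
    · rw [uIoc_of_le hst]
      filter_upwards [ae_restrict_of_ae_restrict_of_subset hsub (huM n),
        ae_restrict_mem measurableSet_Ioc] with r hr hrm
      exact norm_rhs_entry_le hA hr (hρR n r (hsub hrm)) r i j
    · exact (hmI s hs).symm.trans (hmI t hmem)
  let X : ℕ → ℝ → Fin N → Fin N → ℂ := ρ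
  have hXB : ∀ n, ∀ t ∈ Icc t₀ tf, ‖X n t‖ ≤ R := fun n t hmem =>
    (pi_norm_le_iff_of_nonneg (Real.sqrt_nonneg _)).2 fun i =>
      (pi_norm_le_iff_of_nonneg (Real.sqrt_nonneg _)).2 fun j => hρR n t hmem i j
  have hXG : ∀ n, ∀ s ∈ Icc t₀ tf, ∀ t ∈ Icc t₀ tf, ‖X n t - X n s‖ ≤ |G t - G s| := by
    intro n s hs t hmem
    rcases le_total s t with hst | hst
    · exact (pi_norm_le_iff_of_nonneg (abs_nonneg _)).2 fun i =>
        (pi_norm_le_iff_of_nonneg (abs_nonneg _)).2 fun j => hent n s hs t hmem hst i j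
    · rw [norm_sub_rev, abs_sub_comm]
      exact (pi_norm_le_iff_of_nonneg (abs_nonneg _)).2 fun i =>
        (pi_norm_le_iff_of_nonneg (abs_nonneg _)).2 fun j => hent n t hmem s hs hst i j
  obtain ⟨φ, hφ, y, hyc, hy⟩ := exists_subseq_tendsto_of_norm_sub_le X hG hXB hXG
  let σ : ℝ → CMat N := y
  have hσc : ContinuousOn σ (Icc t₀ tf) := hyc
  have hρσ : ∀ t ∈ Icc t₀ tf, Tendsto (fun n => ρ (φ n) t) atTop (𝓝 (σ t)) := hy
  obtain ⟨ψ, hψ, v, hv, hvab, hlim⟩ := exists_subseq_tendsto_integral_mul (fun n => u (φ n))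
    (fun n => humeas (φ n)) (fun n => hucc (φ n))
  have hvM : ∀ᵐ t ∂volume.restrict (Icc t₀ tf), |v t| ≤ M := hvab.mono fun t h => hIM h
  have hρσ' : ∀ t ∈ Icc t₀ tf, Tendsto (fun n => ρ (φ (ψ n)) t) atTop (𝓝 (σ t)) :=
    fun t hmem => (hρσ t hmem).comp hψ.tendsto_atTop
  have hentry : ∀ t ∈ Icc t₀ tf, ∀ i j,
      Tendsto (fun n => ρ (φ (ψ n)) t i j) atTop (𝓝 (σ t i j)) := fun t hmem i j =>
    ((continuous_id.matrix_elem i j).tendsto (σ t)).comp (hρσ' t hmem)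
  have hσR : ∀ t ∈ Icc t₀ tf, ∀ i j, ‖σ t i j‖ ≤ R := fun t hmem i j =>
    le_of_tendsto' (hentry t hmem i j).norm fun n => hρR _ t hmem i j
  have htraj : S.IsTrajectory t₀ tf ρ₀ v σ := by
    refine isTrajectory_of_integral_eq ht
      (fun i j => integrableOn_rhs_entry hA hHc hv hvM hσc hσR i j) fun t hmem i j => ?_
    have h1 := (tendsto_integral_rhs hHc hA0 hA (fun n => humeas (φ (ψ n)))
      (fun n => huM (φ (ψ n))) hv hvM hlim (fun n => hρc (φ (ψ n))) (fun n => hρR (φ (ψ n)))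
      hσc hσR hρσ' hmem i j).const_add (ρ₀ i j)
    refine tendsto_nhds_unique (hentry t hmem i j) (h1.congr fun n => ?_)
    rw [← (hρ (φ (ψ n))).sub_eq_integral (hintg _ i j) le_rfl hmem.1 hmem.2, (hρ (φ (ψ n))).1]
    ring
  refine ⟨φ ∘ ψ, hφ.comp hψ, v, ⟨⟨memLp_top_of_bound hv M hvM, hvab⟩, σ, htraj,
    fun t hmem => ?_⟩, hlim⟩
  exact isClosed_Icc.mem_of_tendsto
    ((continuous_coherence_sq.tendsto (σ t)).comp (hρσ' t hmem))
    (Eventually.of_forall fun n => hcoh _ t hmem)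

theorem controlEnergy_eq (ht : t₀ ≤ tf) (u : ℝ → ℝ) :
    controlEnergy t₀ tf u = ∫ t in Icc t₀ tf, u t ^ 2 := by
  rw [controlEnergy, intervalIntegral.integral_of_le ht, integral_Icc_eq_integral_Ioc]

/-- Existence of a feasible control of least energy. -/
theorem exists_isMinOn_controlEnergy (ht : t₀ ≤ tf)
    (hHc : ∀ i j, IntegrableOn (fun t => S.Hc t i j) (Icc t₀ tf)) {α β : ℝ} {Ω : Set ℝ}
    (hΩ : IsCompact Ω) (hΩc : Convex ℝ Ω) (hΩne : Ω.Nonempty)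
    (hne : (S.feasibleControls t₀ tf ρ₀ α β Ω).Nonempty) :
    ∃ u ∈ S.feasibleControls t₀ tf ρ₀ α β Ω,
      IsMinOn (controlEnergy t₀ tf) (S.feasibleControls t₀ tf ρ₀ α β Ω) u := by
  obtain ⟨a, b, rfl⟩ : ∃ a b, Ω = Icc a b :=
    ⟨_, _, eq_Icc_of_connected_compact ⟨hΩne, hΩc.isPreconnected⟩ hΩ⟩
  set 𝓕 := S.feasibleControls t₀ tf ρ₀ α β (Icc a b) with h𝓕
  have hbdd : BddBelow (controlEnergy t₀ tf '' 𝓕) := by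
    refine ⟨0, ?_⟩
    rintro _ ⟨u, -, rfl⟩
    rw [controlEnergy_eq ht]
    exact integral_nonneg fun t => sq_nonneg _
  obtain ⟨J, -, hJlim, hJmem⟩ := exists_seq_tendsto_sInf (hne.image (controlEnergy t₀ tf)) hbdd
  choose u hu huJ using hJmem
  obtain ⟨φ, hφ, v, hv, hlim⟩ := exists_subseq_feasibleControls ht hHc hu
  have hmem2 : ∀ w ∈ 𝓕, MemLp w 2 (volume.restrict (Icc t₀ tf)) := fun w hw =>
    hw.1.1.mono_exponent le_top
  have hvint : Integrable v (volume.restrict (Icc t₀ tf)) := (hmem2 v hv).integrable one_le_two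
  -- Weak lower semicontinuity by `2uv ≤ u² + v²`: in the limit, twice the energy of `v` is at most
  -- the infimum plus the energy of `v`.
  have hcross : ∀ n, 2 * ∫ t in Icc t₀ tf, u (φ n) t * v t
      ≤ J (φ n) + controlEnergy t₀ tf v := by
    intro n
    rw [← huJ, controlEnergy_eq ht, controlEnergy_eq ht,
      ← integral_add (hmem2 _ (hu _)).integrable_sq (hmem2 v hv).integrable_sq,
      ← integral_const_mul]
    refine integral_mono (((hmem2 _ (hu _)).integrable_mul (hmem2 v hv)).const_mul 2)
      ((hmem2 _ (hu _)).integrable_sq.add (hmem2 v hv).integrable_sq) fun t => ?_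
    simp only
    nlinarith [sq_nonneg (u (φ n) t - v t)]
  have hle := le_of_tendsto_of_tendsto' ((hlim v hvint).const_mul 2)
    ((hJlim.comp hφ.tendsto_atTop).add_const (controlEnergy t₀ tf v)) hcross
  have hvv : ∫ t in Icc t₀ tf, v t * v t = controlEnergy t₀ tf v := by
    rw [controlEnergy_eq ht]
    simp only [sq]
  rw [hvv] at hle
  refine ⟨v, hv, fun w hw => ?_⟩
  have := csInf_le hbdd (mem_image_of_mem _ hw)
  simp only [mem_ofPred_eq]
  linarith

end OpenSystem

end Optimality

/-! ### Choice of the constants and conclusion. -/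

theorem proposition1 {N K : ℕ} (S : OpenSystem N K) (t₀ tf : ℝ) (ht : t₀ ≤ tf)
    (hHc_int : ∀ i j, MeasureTheory.IntegrableOn (fun t => S.Hc t i j) (Set.Icc t₀ tf))
    (hHc_right : ∀ t ∈ Set.Ico t₀ tf, ContinuousWithinAt S.Hc (Set.Ici t) t)
    (ρ₀ : CMat N) (hρ₀ : IsDensityMatrix ρ₀)
    (α β : ℝ) (hC : coherence ρ₀ ^ 2 ∈ Set.Icc α β)
    (ε : ℝ) (hε : 0 < ε) :
    ∃ M : ℝ, 0 < M ∧ ∀ Ω : Set ℝ, Set.Icc (-M) M ⊆ Ω →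
      S.PhiBoundedAway t₀ tf ρ₀ α β Ω ε →
        (S.feasibleControls t₀ tf ρ₀ α β Ω).Nonempty ∧
        (IsCompact Ω → Convex ℝ Ω →
          ∃ u ∈ S.feasibleControls t₀ tf ρ₀ α β Ω,
            IsMinOn (controlEnergy t₀ tf) (S.feasibleControls t₀ tf ρ₀ α β Ω) u) := by
  obtain ⟨C, hC0, hCdiss⟩ := S.exists_frobInner_dissipator_le
  set B : ℝ := frobSq ρ₀ * Real.exp (2 * C * (tf - t₀)) with hB
  have hB0 : 0 ≤ B := mul_nonneg (frobSq_nonneg _) (Real.exp_pos _).le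
  -- The radius exceeds the a priori bound `√B` by one, so that it is positive even if `B = 0`.
  have hR : 0 < √B + 1 := by positivity
  have hBR : B ≤ (√B + 1) ^ 2 := by
    nlinarith [Real.sq_sqrt hB0, Real.sqrt_nonneg B]
  obtain ⟨D, hD0, hD⟩ := S.exists_abs_coherenceDrift_le (√B + 1)
  have hħ := S.hbar_pos
  have he : 0 < ε / (2 * S.hbar) := by positivity
  have heε : S.hbar * (ε / (2 * S.hbar)) < ε := by
    have : S.hbar * (ε / (2 * S.hbar)) = ε / 2 := by field_simp
    linarith
  -- `D / e` bounds the feedback; the summand `1` makes `M` positive when `D = 0`.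
  refine ⟨D / (ε / (2 * S.hbar)) + 1, by positivity, fun Ω hΩ hΦ => ?_⟩
  obtain ⟨u, ρ, hρ, humeas, hu⟩ := OpenSystem.exists_isTrajectory_feedback ht hHc_int hC0 hCdiss
    hR hD0 hBR he hD
  have hctrl : u ∈ OpenSystem.controls t₀ tf Ω := by
    refine ⟨memLp_top_of_bound humeas (D / (ε / (2 * S.hbar))) ?_, ?_⟩
    · filter_upwards [ae_restrict_mem measurableSet_Icc] with t hmem using (hu t hmem).2
    · filter_upwards [ae_restrict_mem measurableSet_Icc] with t hmem
      have := abs_le.1 (hu t hmem).2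
      exact hΩ ⟨by linarith [this.1], by linarith [this.2]⟩
  have hne : (S.feasibleControls t₀ tf ρ₀ α β Ω).Nonempty := by
    refine ⟨u, hctrl, ρ, hρ, fun t hmem => ?_⟩
    rw [OpenSystem.coherence_sq_eq_of_feedback ht hHc_right hρ₀.1.isHermitian hC he heε hΦ hctrl hρ
      (fun t hmem => (hu t hmem).1) hmem]
    exact hC
  refine ⟨hne, fun hcpt hconv => OpenSystem.exists_isMinOn_controlEnergy ht hHc_int hcpt hconv
    ⟨0, hΩ ⟨?_, ?_⟩⟩ hne⟩
  · have : 0 ≤ D / (ε / (2 * S.hbar)) := by positivity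
    linarith
  · positivity
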